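/- Let $\xi=(\xi_n)_{n\ge 1}$ be a stationary and ergodic sequence of random variables on a probability space $(\Omega_E,\mathscr F_E,P)$ with values in the space of probability laws on $\mathbb R$. Given $\xi$, let $X_1,X_2,\dots$ be independent under the quenched probability $\mathbb P_\xi$, with $X_n$ of law $\xi_n$, and put $S_0=0$, $S_n=X_1+\dots+X_n$. Write $\mathbb E_\xi$ for the expectation under $\mathbb P_\xi$ and $\mathbb E$ for the expectation under the annealed probability $\mathbb P(d\xi,dx)=P(d\xi)\,\mathbb P_\xi(dx)$. Assume that $$\mathbb E_\xi(X_1)=0\ \ P\text{-a.s.},\qquad \mathbb E\big(|X_1|^{2+\epsilon}\big)<\infty\ \text{ for some }\epsilon>0,\qquad \mathbb P_\xi(X_1>0)>0\ \ P\text{-a.s.}$$ For $y\ge 0$ let $\tau_y=\inf\{n>0:\ y+S_n\le 0\}$ (with $\inf\emptyset=\infty$) and $U_n(\xi,y)=\mathbb E_\xi(y+S_n;\ \tau_y>n)$. Then for $P$-almost every $\xi$, every $S_n$ is $\mathbb P_\xi$-integrable and, for every $y\ge 0$, we have $\tau_y<\infty$ $\mathbb P_\xi$-a.s., the random variable $S_{\tau_y}$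 is $\mathbb P_\xi$-integrable, and $$\lim_{n\to\infty}U_n(\xi,y)=U(\xi,y):=-\mathbb E_\xi(S_{\tau_y}).$$ Moreover, for every $y\ge 0$, $U(\xi,y)$ is a random variable, namely a measurable function of the environment sequence $\xi$ (with $S_{\tau_y}:=S_m$ on $\{\tau_y=\infty\}$ for some fixed index $m$, and the convention $U(\xi,y)=0$ for the exceptional $\xi$ for which $S_{\tau_y}$ is not integrable). -/

import Mathlib

open MeasureTheory ProbabilityTheory Filter Topology

namespace RWRE

/-- A realization of the environment: a sequence of probability laws on `ℝ`.
Time indices are shifted by one: the entry `n` is the law of the `(n + 1)`-st increment. -/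
abbrev Env : Type := ℕ → ProbabilityMeasure ℝ

/-- The shift `θ (ξ₁, ξ₂, …) = (ξ₂, ξ₃, …)` on environments. -/
def shift (e : Env) : Env := fun n => e (n + 1)

/-- The random sequence `ξ` of probability laws is stationary and ergodic: its law on the space of
sequences is invariant and ergodic under the shift. -/
def IsStationaryErgodic {Ω : Type*} [MeasurableSpace Ω] (P : Measure Ω) (ξ : Ω → Env) : Prop :=
  Ergodic shift (P.map ξ)

/-- The quenched probability: the law of independent increments, the `n`-th one with law `e n`. -/
noncomputable def quenched (e : Env) : Measure (ℕ → ℝ) :=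
  Measure.infinitePi fun n => (e n : Measure ℝ)

instance (e : Env) : IsProbabilityMeasure (quenched e) := by
  unfold quenched; infer_instance

theorem measurable_quenched : Measurable quenched := by
  refine Measurable.measure_of_isPiSystem_of_isProbabilityMeasure
    (generateFrom_squareCylinders (α := fun _ : ℕ => ℝ)).symm
    (isPiSystem_squareCylinders (fun _ => MeasurableSpace.isPiSystem_measurableSet)
      (fun _ => by simp)) ?_
  rintro _ ⟨s, t, ht, rfl⟩
  have ht' : ∀ i, MeasurableSet (t i) := fun i => ht i (Set.mem_univ i)
  have h : ∀ e : Env, quenched e ((s : Set ℕ).pi t) = ∏ i ∈ s, (e i : Measure ℝ) (t i) :=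
    fun e => Measure.infinitePi_pi _ (fun i _ => ht' i)
  simp_rw [h]
  refine Finset.measurable_prod _ fun i _ => ?_
  exact (Measure.measurable_coe (ht' i)).comp (measurable_subtype_coe.comp (measurable_pi_apply i))

/-- The quenched probabilities as a probability kernel. -/
noncomputable def quenchedKernel : Kernel Env (ℕ → ℝ) := ⟨quenched, measurable_quenched⟩

instance : IsMarkovKernel quenchedKernel :=
  ⟨fun e => inferInstanceAs (IsProbabilityMeasure (quenched e))⟩

/-- The annealed (total) probability on the product of the environment space and the path space,
`P(dω) ⊗ P_{ξ(ω)}`. -/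
noncomputable def annealed {Ω : Type*} [MeasurableSpace Ω] (P : Measure Ω) (ξ : Ω → Env)
    (hξ : Measurable ξ) : Measure (Ω × (ℕ → ℝ)) :=
  P ⊗ₘ (quenchedKernel.comap ξ hξ)

/-- The walk started from `0`: `walk n x` is the sum of the first `n` increments. -/
def walk (n : ℕ) (x : ℕ → ℝ) : ℝ := ∑ k ∈ Finset.range n, x k

/-- `τ_y = inf {n > 0 : y + S_n ≤ 0}`, with value `⊤` if there is no such `n`. -/
noncomputable def tau (y : ℝ) : (ℕ → ℝ) → WithTop ℕ :=
  hittingAfter (fun n x => y + walk n x) (Set.Iic 0) 1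

/-- `S_{τ_y}` (with an arbitrary value where `τ_y = ⊤`). -/
noncomputable def walkAtTau (y : ℝ) : (ℕ → ℝ) → ℝ := stoppedValue walk (tau y)

/-- `U_n(ξ, y) = E_ξ(y + S_n; τ_y > n)`. -/
noncomputable def Un (n : ℕ) (e : Env) (y : ℝ) : ℝ :=
  ∫ x in {x | (n : WithTop ℕ) < tau y x}, (y + walk n x) ∂(quenched e)

/-- `U(ξ, y) = - E_ξ(S_{τ_y})`. -/
noncomputable def U (e : Env) (y : ℝ) : ℝ := - ∫ x, walkAtTau y x ∂(quenched e)

end RWRE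

/-! Write `E_ξ(y + S_{n+1}; τ_y > n) = U_n` (centering) and split according to whether the walk is
still positive at time `n + 1`. This gives `U_n - y = E_ξ(overshoot; τ_y ≤ n)`, where the overshoot
`-(y + S_{τ_y})` is nonnegative. So `U_n` increases, and once `U_n` is bounded and `τ_y < ∞` a.s.,
Fatou and dominated convergence give the limit (`IsCentered.tendsto_Un`).

The work is to bound `U_n` for a fixed typical environment. Take scales `l < L` below `√n`. The
future gain of a positive walk is at most about `2l`, since overshoots are controlled by the jumps
and the sum of the `p`-th moments is at most `l ^ p`. If the walk reaches height `L`, this gain is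
at most a fraction `2l / L` of its height. If it stays in `[0, L)`, the gain is not small relative
to the height, but this has probability of order `exp (-V / (6 L²))`, with `V` the accumulated
truncated variance. Hence `U_{2n} ≤ (1 + 2l/L) U_n + 12 l exp (-V / (6 L²))`
(`HasMoment.posMean_add_le_exp`). With `n = 2 ^ j`, `l = n ^ (1/2 - 2δ)` and `L = n ^ (1/2 - δ)` the
errors are summable. The same dichotomy shows that `P_ξ(τ_y > n)` vanishes along dyadic times.

The environment must supply `∑ E|X_k|^p ≤ n ^ (1 + γ)` and `V ≥ n ^ (1 - δ) - 1` along dyadic `n`.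
Both follow from stationarity by integral bounds summable in `j`; the second rests on a logarithmic
inequality for sums along orbits. -/

namespace RWRE

/-! ### First-step decomposition of the quenched walk. -/

/-- The path with first increment `q.1` followed by the increments `q.2`. -/
def consPath (q : ℝ × (ℕ → ℝ)) : ℕ → ℝ
  | 0 => q.1
  | n + 1 => q.2 n

theorem measurable_consPath : Measurable consPath := by
  refine measurable_pi_lambda _ fun n => ?_
  cases n with
  | zero => exact measurable_fst
  | succ n => exact (measurable_pi_apply n).comp measurable_snd

/-- Under the quenched law, the first increment is independent of the following ones, whose law is
the quenched law in the shifted environment. -/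
theorem measurePreserving_consPath (e : Env) :
    MeasurePreserving consPath ((e 0 : Measure ℝ).prod (quenched (shift e))) (quenched e) := by
  refine ⟨measurable_consPath, Measure.eq_infinitePi _ fun s t ht => ?_⟩
  classical
  obtain ⟨N, hN⟩ := s.exists_nat_subset_range
  set t' : ℕ → Set ℝ := fun i => if i ∈ s then t i else Set.univ with ht'
  have ht'm : ∀ i, MeasurableSet (t' i) := fun i => by
    simp only [ht']; split_ifs
    exacts [ht i, MeasurableSet.univ]
  have hpre : consPath ⁻¹' ((s : Set ℕ).pi t)
      = t' 0 ×ˢ ((Finset.range N : Set ℕ).pi fun i => t' (i + 1)) := by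
    ext q
    simp only [Set.mem_preimage, Set.mem_pi, Set.mem_prod, ht', Finset.mem_coe, Finset.mem_range]
    constructor
    · intro h
      refine ⟨?_, fun i _ => ?_⟩
      · split_ifs with h0
        exacts [h 0 h0, trivial]
      · split_ifs with h0
        exacts [h (i + 1) h0, trivial]
    · rintro ⟨h0, h1⟩ i hi
      cases i with
      | zero => rw [if_pos hi] at h0; exact h0
      | succ i =>
        have : i < N := by have := Finset.mem_range.1 (hN hi); omega
        have h2 := h1 i this
        rw [if_pos hi] at h2
        exact h2
  rw [Measure.map_apply measurable_consPath (MeasurableSet.pi s.countable_toSet fun i _ => ht i),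
    hpre, Measure.prod_prod, quenched, Measure.infinitePi_pi _ fun i _ => ht'm (i + 1)]
  have h1 : ∏ i ∈ s, (e i : Measure ℝ) (t i) = ∏ i ∈ s, (e i : Measure ℝ) (t' i) :=
    Finset.prod_congr rfl fun i hi => by simp [ht', hi]
  have h2 : ∏ i ∈ s, (e i : Measure ℝ) (t' i)
      = ∏ i ∈ Finset.range (N + 1), (e i : Measure ℝ) (t' i) :=
    Finset.prod_subset (hN.trans (Finset.range_subset_range.2 N.le_succ))
      fun i _ hi => by simp [ht', hi]
  rw [h1, h2, Finset.prod_range_succ', mul_comm]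
  rfl

theorem integral_quenched (e : Env) {f : (ℕ → ℝ) → ℝ} (hf : Integrable f (quenched e)) :
    ∫ x, f x ∂(quenched e)
      = ∫ a, ∫ x, f (consPath (a, x)) ∂(quenched (shift e)) ∂(e 0 : Measure ℝ) := by
  have h := measurePreserving_consPath e
  rw [← h.map_eq, integral_map h.aemeasurable (by rw [h.map_eq]; exact hf.1)]
  exact integral_prod _ ((integrable_map_measure (by rw [h.map_eq]; exact hf.1) h.aemeasurable).1
    (by rw [h.map_eq]; exact hf))

theorem measurable_walk (n : ℕ) : Measurable (walk n) := by
  unfold walk; fun_prop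

theorem walk_consPath (n : ℕ) (a : ℝ) (x : ℕ → ℝ) :
    walk (n + 1) (consPath (a, x)) = a + walk n x := by
  simp [walk, Finset.sum_range_succ', consPath, add_comm]

theorem lt_tau_iff (n : ℕ) (y : ℝ) (x : ℕ → ℝ) :
    (n : WithTop ℕ) < tau y x ↔ ∀ k < n, 0 < y + walk (k + 1) x := by
  have hle := hittingAfter_le_iff (u := fun n x => y + walk n x) (s := Set.Iic 0) (n := 1)
    (i := n) (ω := x)
  rw [← not_le, tau]
  refine (not_congr hle).trans ?_
  simp only [Set.mem_Icc, Set.mem_Iic, not_exists, not_and, not_le]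
  constructor
  · intro h k hk
    exact h (k + 1) ⟨by omega, by omega⟩
  · rintro h k ⟨hk1, hk2⟩
    obtain ⟨k, rfl⟩ : ∃ l, k = l + 1 := ⟨k - 1, by omega⟩
    exact h k (by omega)

theorem measurableSet_lt_tau (n : ℕ) (y : ℝ) : MeasurableSet {x | (n : WithTop ℕ) < tau y x} := by
  have : {x | (n : WithTop ℕ) < tau y x} = ⋂ k < n, {x | 0 < y + walk (k + 1) x} := by
    ext x; simp [lt_tau_iff]
  rw [this]
  exact MeasurableSet.biInter (Set.to_countable _) fun k _ =>
    measurableSet_lt measurable_const ((measurable_walk _).const_add y)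

theorem succ_lt_tau_consPath (n : ℕ) (y a : ℝ) (x : ℕ → ℝ) :
    ((n + 1 : ℕ) : WithTop ℕ) < tau y (consPath (a, x)) ↔
      0 < y + a ∧ (n : WithTop ℕ) < tau (y + a) x := by
  simp only [lt_tau_iff, walk_consPath]
  constructor
  · intro h
    refine ⟨by simpa [walk] using h 0 (by omega), fun k hk => ?_⟩
    rw [add_assoc]; exact h (k + 1) (by omega)
  · rintro ⟨h0, h1⟩ k hk
    cases k with
    | zero => simpa [walk] using h0
    | succ k => rw [← add_assoc]; exact h1 k (by omega)

theorem zero_lt_tau (y : ℝ) (x : ℕ → ℝ) : ((0 : ℕ) : WithTop ℕ) < tau y x := by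
  rw [lt_tau_iff]; intro k hk; omega

/-! ### Measurability of the stopped walk and of `U`. -/

theorem measurable_walkAtTau (y : ℝ) : Measurable (walkAtTau y) := by
  have htop : MeasurableSet {x | tau y x = ⊤} := by
    have : {x | tau y x = ⊤} = ⋂ n : ℕ, {x | (n : WithTop ℕ) < tau y x} := by
      ext x
      simp only [Set.mem_ofPred_eq, Set.mem_iInter]
      refine ⟨fun h n => by rw [h]; exact WithTop.coe_lt_top n, fun h => ?_⟩
      by_contra hne
      obtain ⟨m, hm⟩ := WithTop.ne_top_iff_exists.1 hne
      exact absurd (h m) (by rw [← hm]; exact lt_irrefl _)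
    rw [this]
    exact MeasurableSet.iInter fun n => measurableSet_lt_tau n y
  have heq : ∀ k : ℕ, MeasurableSet {x | tau y x = k} := fun k => by
    have : {x | tau y x = k} = {x | (k : WithTop ℕ) < tau y x}ᶜ ∩
        ⋂ m < k, {x | (m : WithTop ℕ) < tau y x} := by
      ext x
      simp only [Set.mem_ofPred_eq, Set.mem_iInter, Set.mem_inter_iff, Set.mem_compl_iff, not_lt]
      refine ⟨fun h => ⟨h.le, fun m hm => by rw [h]; exact_mod_cast hm⟩, fun ⟨h1, h2⟩ => ?_⟩
      obtain ⟨m, hm⟩ := WithTop.ne_top_iff_exists.1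
        (ne_top_of_le_ne_top (WithTop.coe_ne_top (a := k)) h1)
      rw [← hm] at h1 h2 ⊢
      refine congrArg _ (le_antisymm (WithTop.coe_le_coe.1 h1) (not_lt.1 fun hlt => ?_))
      exact lt_irrefl _ (h2 m hlt)
    rw [this]
    exact (measurableSet_lt_tau k y).compl.inter
      (MeasurableSet.biInter (Set.to_countable _) fun m _ => measurableSet_lt_tau m y)
  have hun : Measurable fun x => (tau y x).untopA := by
    refine measurable_to_countable' fun k => ?_
    -- `untopA` sends `⊤` to one fixed index, so the event `τ_y = ⊤` is added to the fibre of that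
    -- single `k`.
    have : (fun x => (tau y x).untopA) ⁻¹' {k} = {x | tau y x = k} ∪
        ({x | tau y x = ⊤} ∩ {_x | (⊤ : WithTop ℕ).untopA = k}) := by
      ext x
      simp only [Set.mem_preimage, Set.mem_singleton_iff, Set.mem_union, Set.mem_inter_iff,
        Set.mem_ofPred_eq]
      by_cases h : tau y x = ⊤
      · simp [h]
      · obtain ⟨m, hm⟩ := WithTop.ne_top_iff_exists.1 h
        rw [← hm]
        simp only [WithTop.coe_ne_top, false_and, or_false]
        exact WithTop.coe_inj.symm
    rw [this]
    exact (heq k).union (htop.inter (MeasurableSet.const _))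
  have h : Measurable fun q : ℕ × (ℕ → ℝ) => walk q.1 q.2 :=
    measurable_from_prod_countable_right fun n => measurable_walk n
  exact h.comp (hun.prodMk measurable_id)

theorem measurable_U (y : ℝ) : Measurable fun e : Env => U e y := by
  have h := (measurable_walkAtTau y).stronglyMeasurable.integral_kernel (κ := quenchedKernel)
  exact h.measurable.neg

/-! ### Centered increments and the recursion for the killed walk. -/

/-- The increments are integrable and centered. -/
def IsCentered (e : Env) : Prop :=
  ∀ k, Integrable (fun x : ℝ => x) (e k : Measure ℝ) ∧ ∫ x, x ∂(e k : Measure ℝ) = 0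

theorem IsCentered.shift {e : Env} (he : IsCentered e) : IsCentered (shift e) := fun k => he (k + 1)

theorem measurePreserving_eval_quenched (e : Env) (k : ℕ) :
    MeasurePreserving (fun x : ℕ → ℝ => x k) (quenched e) (e k : Measure ℝ) :=
  measurePreserving_eval_infinitePi _ k

theorem IsCentered.integrable_eval {e : Env} (he : IsCentered e) (k : ℕ) :
    Integrable (fun x : ℕ → ℝ => x k) (quenched e) :=
  (measurePreserving_eval_quenched e k).integrable_comp_of_integrable (he k).1

theorem IsCentered.integrable_walk {e : Env} (he : IsCentered e) (n : ℕ) :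
    Integrable (walk n) (quenched e) :=
  integrable_finsetSum _ fun k _ => he.integrable_eval k

/-- On the event that the walk has not yet left `(0, ∞)`, the next increment has mean zero. -/
theorem IsCentered.setIntegral_eval {n : ℕ} {e : Env} (he : IsCentered e) (y : ℝ) :
    ∫ x in {x | (n : WithTop ℕ) < tau y x}, x n ∂(quenched e) = 0 := by
  induction n generalizing e y with
  | zero =>
    simp only [zero_lt_tau, Set.ofPred_true, Measure.restrict_univ]
    have h := measurePreserving_eval_quenched e 0
    rw [← (he 0).2, ← h.map_eq, integral_map h.aemeasurable (by fun_prop)]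
  | succ n ih =>
    rw [← integral_indicator (measurableSet_lt_tau _ _),
      integral_quenched e ((he.integrable_eval _).indicator (measurableSet_lt_tau _ _))]
    refine integral_eq_zero_of_ae (ae_of_all _ fun a => ?_)
    by_cases ha : 0 < y + a
    · refine Eq.trans ?_ (ih he.shift (y + a))
      rw [← integral_indicator (measurableSet_lt_tau _ _)]
      refine integral_congr_ae (ae_of_all _ fun x => ?_)
      simp only [Set.indicator, Set.mem_ofPred_eq, succ_lt_tau_consPath, ha, true_and, consPath]
    · simp only [Set.indicator, Set.mem_ofPred_eq, succ_lt_tau_consPath, ha, false_and,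
        if_false, integral_zero, Pi.zero_apply]

/-- The iterated one-step expectations of `f` for the walk started from `z` and killed upon leaving
`R` (at positive times). -/
noncomputable def killed (R : Set ℝ) (f : ℝ → ℝ) : ℕ → Env → ℝ → ℝ
  | 0, _, z => f z
  | n + 1, e, z => ∫ x, R.indicator (killed R f n (shift e)) (z + x) ∂(e 0 : Measure ℝ)

theorem measurable_killed {R : Set ℝ} (hR : MeasurableSet R) {f : ℝ → ℝ} (hf : Measurable f)
    (n : ℕ) (e : Env) : Measurable (killed R f n e) := by
  induction n generalizing e with
  | zero => exact hf
  | succ n ih =>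
    have h : Measurable fun q : ℝ × ℝ => R.indicator (killed R f n (RWRE.shift e)) (q.1 + q.2) :=
      ((ih _).indicator hR).comp (measurable_fst.add measurable_snd)
    exact (h.stronglyMeasurable.integral_prod_right (ν := (e 0 : Measure ℝ))).measurable

/-- Conditioning on the first increment turns path expectations into the recursion `killed`, where
estimates go by induction on time over all environments. The linear growth bound covers both uses,
`f z = z` and `f = 1`. -/
theorem IsCentered.setIntegral_lt_tau {f : ℝ → ℝ} (hf : Measurable f) (hfb : ∀ z, |f z| ≤ 1 + |z|)
    {n : ℕ} {e : Env} (he : IsCentered e) (y : ℝ) :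
    ∫ x in {x | (n : WithTop ℕ) < tau y x}, f (y + walk n x) ∂(quenched e)
      = killed (Set.Ioi 0) f n e y := by
  have hint : ∀ (n : ℕ) {e : Env} (_ : IsCentered e) (y : ℝ),
      Integrable (fun x => f (y + walk n x)) (quenched e) := fun n e he y => by
    refine Integrable.mono' (g := fun x => 1 + |y + walk n x|)
      ((integrable_const _).add (((integrable_const _).add (he.integrable_walk n)).abs)) ?_
      (ae_of_all _ fun x => hfb _)
    exact (hf.comp ((measurable_walk n).const_add y)).aestronglyMeasurable
  induction n generalizing e y with
  | zero => simp only [zero_lt_tau, Set.ofPred_true, Measure.restrict_univ]; simp [killed, walk]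
  | succ n ih =>
    rw [← integral_indicator (measurableSet_lt_tau _ _),
      integral_quenched e ((hint _ he y).indicator (measurableSet_lt_tau _ _)), killed]
    refine integral_congr_ae (ae_of_all _ fun a => ?_)
    by_cases ha : 0 < y + a
    · simp only [Set.indicator_of_mem (Set.mem_Ioi.2 ha), ← ih he.shift (y + a)]
      rw [← integral_indicator (measurableSet_lt_tau _ _)]
      refine integral_congr_ae (ae_of_all _ fun x => ?_)
      simp only [Set.indicator, Set.mem_ofPred_eq, succ_lt_tau_consPath, ha, true_and,
        walk_consPath, add_assoc]
    · simp only [Set.indicator, Set.mem_ofPred_eq, succ_lt_tau_consPath, Set.mem_Ioi, ha, false_and,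
        if_false, integral_zero]

/-! ### The overshoot and the passage to the limit. -/

/-- The overshoot below `0` of the walk started from `y`, on the event `τ_y ≤ n`. -/
noncomputable def overshoot (y : ℝ) (n : ℕ) : (ℕ → ℝ) → ℝ :=
  {x | (n : WithTop ℕ) < tau y x}ᶜ.indicator fun x => -(y + walkAtTau y x)

theorem measurable_overshoot (y : ℝ) (n : ℕ) : Measurable (overshoot y n) :=
  ((measurable_walkAtTau y).const_add y).neg.indicator (measurableSet_lt_tau n y).compl

theorem walkAtTau_of_eq {y : ℝ} {n : ℕ} {x : ℕ → ℝ} (h : tau y x = (n : WithTop ℕ)) :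
    walkAtTau y x = walk n x := by
  rw [walkAtTau, stoppedValue, h]; rfl

theorem exists_tau_eq {y : ℝ} {n : ℕ} {x : ℕ → ℝ} (h : ¬ (n : WithTop ℕ) < tau y x) :
    ∃ k ≤ n, tau y x = (k : WithTop ℕ) ∧ y + walk k x ≤ 0 := by
  obtain ⟨k, hk⟩ := WithTop.ne_top_iff_exists.1
    (ne_top_of_le_ne_top (WithTop.coe_ne_top (a := n)) (not_lt.1 h))
  refine ⟨k, ?_, hk.symm, ?_⟩
  · rw [← hk] at h
    exact WithTop.coe_le_coe.1 (not_lt.1 h)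
  · by_contra! hpos
    have h1 : ¬ (k : WithTop ℕ) < tau y x := by rw [← hk]; exact lt_irrefl _
    refine h1 ((lt_tau_iff k y x).2 fun l hl => ?_)
    rcases Nat.lt_or_ge (l + 1) k with hlk | hlk
    · have h2 : ((k - 1 : ℕ) : WithTop ℕ) < tau y x := by
        rw [← hk]; exact Nat.cast_lt.2 (by omega)
      exact (lt_tau_iff _ _ _).1 h2 l (by omega)
    · rwa [show l + 1 = k by omega]

theorem overshoot_nonneg (y : ℝ) (n : ℕ) (x : ℕ → ℝ) : 0 ≤ overshoot y n x := by
  refine Set.indicator_apply_nonneg fun h => ?_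
  obtain ⟨k, _, hk, hk'⟩ := exists_tau_eq h
  rw [walkAtTau_of_eq hk]; linarith

theorem overshoot_zero (y : ℝ) (x : ℕ → ℝ) : overshoot y 0 x = 0 :=
  Set.indicator_of_notMem (a := x) (not_not_intro (zero_lt_tau y x)) _

theorem lt_tau_of_succ_lt {y : ℝ} {n : ℕ} {x : ℕ → ℝ} (h : ((n + 1 : ℕ) : WithTop ℕ) < tau y x) :
    (n : WithTop ℕ) < tau y x :=
  lt_trans (WithTop.coe_lt_coe.2 n.lt_succ_self) h

/-- On `τ_y > n` the value `y + S_{n+1}` is either kept (still alive) or turned into overshoot (`τ_y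
= n + 1`). Integrating this pathwise identity telescopes `U_n`, because the term with the next
increment has mean zero. -/
theorem overshoot_succ (y : ℝ) (n : ℕ) (x : ℕ → ℝ) :
    overshoot y (n + 1) x = overshoot y n x
      - {x | (n : WithTop ℕ) < tau y x}.indicator (fun x => y + walk n x) x
      - {x | (n : WithTop ℕ) < tau y x}.indicator (fun x => x n) x
      + {x | ((n + 1 : ℕ) : WithTop ℕ) < tau y x}.indicator (fun x => y + walk (n + 1) x) x := by
  have hw : walk (n + 1) x = walk n x + x n := Finset.sum_range_succ _ _
  simp only [overshoot, Set.indicator, Set.mem_compl_iff, Set.mem_ofPred_eq]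
  by_cases h : (n : WithTop ℕ) < tau y x
  · by_cases h' : ((n + 1 : ℕ) : WithTop ℕ) < tau y x
    · simp only [h, h', not_true_eq_false, if_true, if_false]; linarith
    · obtain ⟨k, hk, hk', _⟩ := exists_tau_eq h'
      have : k = n + 1 := by
        rw [hk'] at h
        have := Nat.cast_lt.1 h
        omega
      subst this
      simp only [h, h', not_true_eq_false, not_false_eq_true, if_true, if_false,
        walkAtTau_of_eq hk']
      linarith
  · have h' : ¬ ((n + 1 : ℕ) : WithTop ℕ) < tau y x := fun h' => h (lt_tau_of_succ_lt h')
    simp only [h, h', not_false_eq_true, if_true, if_false]; linarith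

theorem monotone_overshoot (y : ℝ) (x : ℕ → ℝ) : Monotone fun n => overshoot y n x := by
  refine monotone_nat_of_le_succ fun n => ?_
  by_cases h : (n : WithTop ℕ) < tau y x
  · have : overshoot y n x = 0 := Set.indicator_of_notMem (a := x) (not_not_intro h) _
    rw [this]; exact overshoot_nonneg _ _ _
  · have h' : ¬ ((n + 1 : ℕ) : WithTop ℕ) < tau y x := fun h' => h (lt_tau_of_succ_lt h')
    exact (show overshoot y n x = overshoot y (n + 1) x by
      simp [overshoot, Set.indicator, h, h', -Nat.cast_add]).le

theorem IsCentered.integrable_overshoot {e : Env} (he : IsCentered e) (y : ℝ) (n : ℕ) :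
    Integrable (overshoot y n) (quenched e) ∧
      ∫ x, overshoot y n x ∂(quenched e) = Un n e y - y := by
  have hw : ∀ n, Integrable (fun x => y + walk n x) (quenched e) := fun n =>
    (integrable_const _).add (he.integrable_walk n)
  induction n with
  | zero =>
    have h0 : overshoot y 0 = fun _ => 0 := funext (overshoot_zero y)
    have h1 : Un 0 e y = y := by
      simp only [Un, zero_lt_tau, Set.ofPred_true, Measure.restrict_univ]; simp [walk]
    simp [h0, h1]
  | succ n ih =>
    have hs : overshoot y (n + 1) = _ := funext (overshoot_succ y n)
    have i1 := (hw n).indicator (measurableSet_lt_tau n y)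
    have i2 := (he.integrable_eval n).indicator (measurableSet_lt_tau n y)
    have i3 := (hw (n + 1)).indicator (measurableSet_lt_tau (n + 1) y)
    rw [hs]
    refine ⟨((ih.1.sub i1).sub i2).add i3, ?_⟩
    have e1 := integral_add ((ih.1.sub i1).sub i2) i3
    have e2 := integral_sub (ih.1.sub i1) i2
    have e3 := integral_sub ih.1 i1
    simp only [Pi.sub_apply] at e1 e2 e3
    rw [e1, e2, e3, ih.2, integral_indicator (measurableSet_lt_tau _ _),
      integral_indicator (measurableSet_lt_tau _ _), integral_indicator (measurableSet_lt_tau _ _),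
      he.setIntegral_eval]
    simp only [Un]
    ring

theorem IsCentered.monotone_Un {e : Env} (he : IsCentered e) (y : ℝ) :
    Monotone fun n => Un n e y := fun m n hmn => by
  have := integral_mono (he.integrable_overshoot y m).1 (he.integrable_overshoot y n).1
    fun x => monotone_overshoot y x hmn
  rw [(he.integrable_overshoot y m).2, (he.integrable_overshoot y n).2] at this
  exact (sub_le_sub_iff_right y).1 this

/-- The overshoots up to time `n` have mean `U_n - y ≤ C - y` and are eventually equal to `-(y +
S_{τ_y})`. Fatou makes this limit integrable, and it then dominates all of them. -/
theorem IsCentered.tendsto_Un {e : Env} (he : IsCentered e) {y C : ℝ} (hC : ∀ n, Un n e y ≤ C)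
    (htau : ∀ᵐ x ∂(quenched e), tau y x < ⊤) :
    Integrable (walkAtTau y) (quenched e) ∧
      Tendsto (fun n : ℕ => Un n e y) atTop (𝓝 (U e y)) := by
  have hlim : ∀ᵐ x ∂(quenched e),
      ∀ᶠ n : ℕ in atTop, overshoot y n x = -(y + walkAtTau y x) := by
    filter_upwards [htau] with x hx
    obtain ⟨m, hm⟩ := WithTop.ne_top_iff_exists.1 hx.ne
    filter_upwards [eventually_ge_atTop m] with n hn
    refine Set.indicator_of_mem (a := x) (fun h => ?_) _
    rw [Set.mem_ofPred_eq, ← hm] at h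
    exact absurd (Nat.cast_lt.1 h) (by omega)
  have hlim' : ∀ᵐ x ∂(quenched e),
      Tendsto (fun n : ℕ => overshoot y n x) atTop (𝓝 (-(y + walkAtTau y x))) :=
    hlim.mono fun x hx => tendsto_const_nhds.congr' (hx.mono fun n hn => hn.symm)
  have hmeas : Measurable fun x => -(y + walkAtTau y x) :=
    ((measurable_walkAtTau y).const_add y).neg
  have hint : Integrable (fun x => -(y + walkAtTau y x)) (quenched e) := by
    refine ⟨hmeas.aestronglyMeasurable, ?_⟩
    have hle : ∀ n, ∫⁻ x, ‖overshoot y n x‖ₑ ∂(quenched e) ≤ ENNReal.ofReal (C - y) := fun n => by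
      have h := he.integrable_overshoot y n
      simp_rw [fun x => Real.enorm_of_nonneg (overshoot_nonneg y n x)]
      rw [← ofReal_integral_eq_lintegral_ofReal h.1 (ae_of_all _ (overshoot_nonneg y n)), h.2]
      exact ENNReal.ofReal_le_ofReal (by linarith [hC n])
    calc ∫⁻ x, ‖-(y + walkAtTau y x)‖ₑ ∂(quenched e)
        ≤ ∫⁻ x, liminf (fun n => ‖overshoot y n x‖ₑ) atTop ∂(quenched e) :=
          lintegral_mono_ae (hlim'.mono fun x hx => hx.enorm.liminf_eq.ge)
      _ ≤ liminf (fun n => ∫⁻ x, ‖overshoot y n x‖ₑ ∂(quenched e)) atTop :=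
          lintegral_liminf_le fun n => (measurable_overshoot y n).enorm
      _ ≤ ENNReal.ofReal (C - y) :=
          liminf_le_of_le (by isBoundedDefault) fun b hb => by
            obtain ⟨n, hn⟩ := hb.exists
            exact hn.trans (hle n)
      _ < ⊤ := ENNReal.ofReal_lt_top
  have hW : Integrable (walkAtTau y) (quenched e) := by
    have := (hint.neg.sub (integrable_const y))
    refine this.congr (ae_of_all _ fun x => ?_)
    simp
  refine ⟨hW, ?_⟩
  have hT := tendsto_integral_of_dominated_convergence (fun x => ‖-(y + walkAtTau y x)‖)
    (fun n => (measurable_overshoot y n).aestronglyMeasurable) hint.norm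
    (fun n => ae_of_all _ fun x => norm_indicator_le_norm_self _ _) hlim'
  simp_rw [fun n => (he.integrable_overshoot y n).2] at hT
  have hI : ∫ x, -(y + walkAtTau y x) ∂(quenched e) = U e y - y := by
    rw [integral_neg, integral_add (integrable_const y) hW]
    simp [U]; ring
  rw [hI] at hT
  simpa using hT.add_const y

theorem ae_tau_lt_top {e : Env} {y : ℝ} {u : ℕ → ℝ} (hu : Tendsto u atTop (𝓝 0)) (N : ℕ → ℕ)
    (h : ∀ᶠ j in atTop, (quenched e).real {x | (N j : WithTop ℕ) < tau y x} ≤ u j) :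
    ∀ᵐ x ∂(quenched e), tau y x < ⊤ := by
  have hle : ∀ᶠ j in atTop, (quenched e).real {x | ¬ tau y x < ⊤} ≤ u j := by
    filter_upwards [h] with j hj
    refine (measureReal_mono fun x hx => ?_).trans hj
    have : tau y x = ⊤ := by simpa using hx
    rw [Set.mem_ofPred_eq, this]; exact WithTop.coe_lt_top _
  have h0 := le_antisymm (ge_of_tendsto hu hle) measureReal_nonneg
  rw [ae_iff]
  exact (measureReal_eq_zero_iff).1 h0

/-! ### Estimates for the killed walk in a fixed environment. -/

theorem rpow_le_add_mul_rpow {a p l x : ℝ} (hap : a ≤ p) (ha : 0 ≤ a) (hl : 0 < l) (hx : 0 ≤ x) :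
    x ^ a ≤ l ^ a + l ^ (a - p) * x ^ p := by
  rcases le_or_gt x l with h | h
  · have := Real.rpow_le_rpow hx h ha
    have : 0 ≤ l ^ (a - p) * x ^ p := by positivity
    linarith
  · have hx' : 0 < x := hl.trans h
    have h1 : x ^ p = x ^ a * x ^ (p - a) := by rw [← Real.rpow_add hx']; ring_nf
    have h2 : l ^ (p - a) ≤ x ^ (p - a) := Real.rpow_le_rpow hl.le h.le (by linarith)
    have h3 : l ^ (a - p) * l ^ (p - a) = 1 := by rw [← Real.rpow_add hl]; simp
    have h4 : x ^ a ≤ l ^ (a - p) * x ^ p := by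
      calc x ^ a = x ^ a * (l ^ (a - p) * l ^ (p - a)) := by rw [h3, mul_one]
        _ ≤ x ^ a * (l ^ (a - p) * x ^ (p - a)) := by gcongr
        _ = l ^ (a - p) * x ^ p := by rw [h1]; ring
    have : 0 < l ^ a := by positivity
    linarith

/-- The increments are centered and have finite absolute moments of order `p`. -/
structure HasMoment (p : ℝ) (e : Env) : Prop where
  toIsCentered : IsCentered e
  integrable_rpow : ∀ k, Integrable (fun x : ℝ => |x| ^ p) (e k : Measure ℝ)

theorem HasMoment.shift {p : ℝ} {e : Env} (he : HasMoment p e) : HasMoment p (shift e) :=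
  ⟨he.toIsCentered.shift, fun k => he.integrable_rpow (k + 1)⟩

/-- The absolute moment of order `p` of a law. -/
noncomputable def absMoment (p : ℝ) (μ : ProbabilityMeasure ℝ) : ℝ := ∫ x, |x| ^ p ∂(μ : Measure ℝ)

/-- The second moment of a law, truncated at `1`. -/
noncomputable def truncVar (μ : ProbabilityMeasure ℝ) : ℝ := min (∫ x, x ^ 2 ∂(μ : Measure ℝ)) 1

theorem absMoment_nonneg (p : ℝ) (μ : ProbabilityMeasure ℝ) : 0 ≤ absMoment p μ :=
  integral_nonneg fun _ => by positivity

theorem truncVar_nonneg (μ : ProbabilityMeasure ℝ) : 0 ≤ truncVar μ :=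
  le_min (integral_nonneg fun _ => by positivity) zero_le_one

/-- The sum of the first `n` moments of order `p`. -/
noncomputable def momentSum (p : ℝ) (n : ℕ) (e : Env) : ℝ := ∑ k ∈ Finset.range n, absMoment p (e k)

/-- The sum of the first `n` truncated variances. -/
noncomputable def varSum (n : ℕ) (e : Env) : ℝ := ∑ k ∈ Finset.range n, truncVar (e k)

theorem momentSum_succ (p : ℝ) (n : ℕ) (e : Env) :
    momentSum p (n + 1) e = momentSum p n (shift e) + absMoment p (e 0) :=
  Finset.sum_range_succ' _ _

theorem varSum_succ (n : ℕ) (e : Env) : varSum (n + 1) e = varSum n (shift e) + truncVar (e 0) :=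
  Finset.sum_range_succ' _ _

theorem momentSum_nonneg (p : ℝ) (n : ℕ) (e : Env) : 0 ≤ momentSum p n e :=
  Finset.sum_nonneg fun _ _ => absMoment_nonneg _ _

theorem momentSum_mono (p : ℝ) (e : Env) : Monotone fun n => momentSum p n e := fun _ _ h =>
  Finset.sum_le_sum_of_subset_of_nonneg (Finset.range_subset_range.2 h)
    fun _ _ _ => absMoment_nonneg _ _

/-- The expectation of the walk from `z` on the event that it stays positive up to time `n`. -/
noncomputable abbrev posMean : ℕ → Env → ℝ → ℝ := killed (Set.Ioi 0) fun z => z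

/-- The probability that the walk from `z` stays in `R` up to time `n`. -/
noncomputable abbrev stayProb (R : Set ℝ) : ℕ → Env → ℝ → ℝ := killed R fun _ => 1

theorem stayProb_mem_Icc (R : Set ℝ) (n : ℕ) (e : Env) (z : ℝ) :
    0 ≤ stayProb R n e z ∧ stayProb R n e z ≤ 1 := by
  induction n generalizing e z with
  | zero => simp [stayProb, killed]
  | succ n ih =>
    have h0 : ∀ x, 0 ≤ R.indicator (stayProb R n (shift e)) (z + x) := fun x =>
      Set.indicator_apply_nonneg fun _ => (ih _ _).1
    have h1 : ∀ x, R.indicator (stayProb R n (shift e)) (z + x) ≤ 1 := fun x =>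
      Set.indicator_apply_le' (fun _ => (ih _ _).2) fun _ => zero_le_one
    refine ⟨integral_nonneg h0, ?_⟩
    calc stayProb R (n + 1) e z ≤ ∫ _, (1 : ℝ) ∂(e 0 : Measure ℝ) :=
          integral_mono_of_nonneg (ae_of_all _ h0) (integrable_const _) (ae_of_all _ h1)
      _ = 1 := by simp

theorem integrable_indicator_stayProb {R : Set ℝ} (hR : MeasurableSet R) (n : ℕ) (e : Env) (z : ℝ)
    (μ : ProbabilityMeasure ℝ) :
    Integrable (fun x => R.indicator (stayProb R n e) (z + x)) (μ : Measure ℝ) := by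
  refine Integrable.mono' (integrable_const (1 : ℝ))
    (((measurable_killed hR measurable_const n e).indicator hR).comp
      (measurable_const_add z)).aestronglyMeasurable (ae_of_all _ fun x => ?_)
  rw [Real.norm_of_nonneg (Set.indicator_apply_nonneg fun _ => (stayProb_mem_Icc _ _ _ _).1)]
  exact Set.indicator_apply_le' (fun _ => (stayProb_mem_Icc _ _ _ _).2) fun _ => zero_le_one

section

variable {p : ℝ} {e : Env}

theorem integrable_indicator_of_le {g : ℝ → ℝ} (hg : Measurable g) {A : ℝ}
    (hle : ∀ z, 0 ≤ z → z ≤ g z ∧ g z ≤ z + A) (he : IsCentered e) (z : ℝ) :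
    Integrable (fun x => (Set.Ioi 0).indicator g (z + x)) (e 0 : Measure ℝ) := by
  refine Integrable.mono' (g := fun x => |z + x| + |A|)
    (((integrable_const _).add (he 0).1).abs.add (integrable_const _))
    ((hg.indicator measurableSet_Ioi).comp (measurable_const_add z)).aestronglyMeasurable
    (ae_of_all _ fun x => ?_)
  by_cases h : 0 < z + x
  · obtain ⟨h1, h2⟩ := hle _ h.le
    rw [Set.indicator_of_mem (Set.mem_Ioi.2 h), Real.norm_of_nonneg (h.le.trans h1), abs_of_pos h]
    exact h2.trans (by gcongr; exact le_abs_self A)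
  · rw [Set.indicator_of_notMem (by simpa using h), norm_zero]
    positivity

/-- Lower bound: killing only removes nonpositive values of a martingale. Upper bound: what killing
adds is the overshoot, at most the size of the exit jump, hence at most `l` plus the sum of all `l ^
(1 - p) * |X_k| ^ p`. -/
theorem HasMoment.posMean_bounds (he : HasMoment p e) (hp : 1 ≤ p) {l : ℝ} (hl : 0 < l) (n : ℕ)
    {z : ℝ} (hz : 0 ≤ z) :
    z ≤ posMean n e z ∧ posMean n e z ≤ z + (l + l ^ (1 - p) * momentSum p n e) := by
  induction n generalizing e z with
  | zero =>
    simp [posMean, killed, momentSum, hl.le]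
  | succ n ih =>
    have hlp : 0 < l ^ (1 - p) := by positivity
    have hM := momentSum_nonneg p n (RWRE.shift e)
    have hint := integrable_indicator_of_le (measurable_killed measurableSet_Ioi measurable_id n _)
      (fun z hz => ih he.shift hz) he.toIsCentered z
    obtain ⟨hi, hm⟩ := he.toIsCentered 0
    constructor
    · calc z = ∫ x, (z + x) ∂(e 0 : Measure ℝ) := by
            rw [integral_add (integrable_const _) hi, hm]; simp
        _ ≤ posMean (n + 1) e z := by
            refine integral_mono ((integrable_const _).add hi) hint fun x => ?_
            by_cases h : 0 < z + x
            · simpa only [Set.indicator_of_mem (Set.mem_Ioi.2 h)] using (ih he.shift h.le).1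
            · simp only [Set.indicator_of_notMem (show z + x ∉ Set.Ioi 0 by simpa using h)]
              exact not_lt.1 h
    · have hip := he.integrable_rpow 0
      calc posMean (n + 1) e z
          ≤ ∫ x, ((z + (l + l ^ (1 - p) * momentSum p n (RWRE.shift e)) + x)
              + l ^ (1 - p) * |x| ^ p) ∂(e 0 : Measure ℝ) := by
            refine integral_mono hint
              (((integrable_const _).add hi).add (hip.const_mul _)) fun x => ?_
            -- Needed on exit: there the majorant must be nonnegative, and since `z ≥ 0` this costs
            -- at most `|x|`.
            have hx : |x| ≤ l + l ^ (1 - p) * |x| ^ p := by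
              simpa using rpow_le_add_mul_rpow hp zero_le_one hl (abs_nonneg x)
            have h0 : 0 ≤ l ^ (1 - p) * |x| ^ p := by positivity
            have h1 : 0 ≤ l ^ (1 - p) * momentSum p n (RWRE.shift e) := by positivity
            by_cases h : 0 < z + x
            · have := (ih he.shift h.le).2
              simp only [Set.indicator_of_mem (Set.mem_Ioi.2 h)]
              linarith
            · simp only [Set.indicator_of_notMem (show z + x ∉ Set.Ioi 0 by simpa using h)]
              linarith [neg_abs_le x]
        _ = z + (l + l ^ (1 - p) * momentSum p (n + 1) e) := by
            have j : Integrable (fun x : ℝ =>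
                z + (l + l ^ (1 - p) * momentSum p n (RWRE.shift e)) + x) (e 0 : Measure ℝ) :=
              (integrable_const _).add hi
            rw [integral_add j (hip.const_mul _), integral_add (integrable_const _) hi, hm,
              integral_const_mul, momentSum_succ]
            simp [absMoment]; ring

theorem HasMoment.integrable_indicator_posMean (he : HasMoment p e) (hp : 1 ≤ p) (n : ℕ) (z : ℝ) :
    Integrable (fun x => (Set.Ioi 0).indicator (posMean n (RWRE.shift e)) (z + x))
      (e 0 : Measure ℝ) :=
  integrable_indicator_of_le (measurable_killed measurableSet_Ioi measurable_id n _)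
    (fun _ hz => he.shift.posMean_bounds hp zero_lt_one n hz) he.toIsCentered z

/-- `K` bounds the gain over the remaining time. Stop when the walk leaves `[0, L)`: at a height `z
≥ L` the gain is absorbed by `K ≤ (K / L) * z`, and below `0` nothing remains. Only paths inside
`[0, L)` throughout pay `K` additively. -/
theorem HasMoment.posMean_add_le (he : HasMoment p e) (hp : 1 ≤ p) {l L K : ℝ} (hl : 0 < l)
    (hL : 0 < L) (n k : ℕ) (hK : l + l ^ (1 - p) * momentSum p (n + k) e ≤ K) {z : ℝ}
    (hz : 0 ≤ z) :
    posMean (n + k) e z ≤ (1 + K / L) * posMean n e z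
      + K * (Set.Ico 0 L).indicator (stayProb (Set.Ico 0 L) n e) z := by
  have hK0 : 0 ≤ K := le_trans (by have := momentSum_nonneg p (n + k) e; positivity) hK
  have hlarge : ∀ {m : ℕ} {e : Env} {z : ℝ}, HasMoment p e → 0 ≤ z → L ≤ z →
      z + K ≤ (1 + K / L) * posMean m e z := fun {m e z} he hz hLz => by
    have h1 := (he.posMean_bounds hp hl m hz).1
    calc z + K = z + K / L * L := by field_simp
      _ ≤ z + K / L * z := by gcongr
      _ = (1 + K / L) * z := by ring
      _ ≤ _ := by gcongr
  induction n generalizing e z with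
  | zero =>
    have h1 := (he.posMean_bounds hp hl (0 + k) hz).2
    by_cases hLz : L ≤ z
    · rw [Set.indicator_of_notMem (by simp [hLz]), mul_zero, add_zero]
      exact h1.trans (le_trans (by linarith) (hlarge he hz hLz))
    · rw [Set.indicator_of_mem (Set.mem_Ico.2 ⟨hz, not_le.1 hLz⟩)]
      have : 0 ≤ K / L * z := by positivity
      simp only [posMean, stayProb, killed] at h1 ⊢
      linarith
  | succ n ih =>
    rw [show n + 1 + k = n + k + 1 by ring] at hK ⊢
    by_cases hLz : L ≤ z
    · rw [Set.indicator_of_notMem (by simp [hLz]), mul_zero, add_zero]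
      exact (he.posMean_bounds hp hl _ hz).2.trans (le_trans (by linarith) (hlarge he hz hLz))
    · rw [Set.indicator_of_mem (Set.mem_Ico.2 ⟨hz, not_le.1 hLz⟩)]
      have hK' : l + l ^ (1 - p) * momentSum p (n + k) (RWRE.shift e) ≤ K := by
        refine le_trans ?_ hK
        rw [momentSum_succ]
        have := absMoment_nonneg p (e 0)
        gcongr
        linarith
      have i1 := he.integrable_indicator_posMean hp n z
      have i2 := integrable_indicator_stayProb (measurableSet_Ico (a := 0) (b := L)) n
        (RWRE.shift e) z (e 0)
      calc posMean (n + k + 1) e z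
          ≤ ∫ x, ((1 + K / L) * (Set.Ioi 0).indicator (posMean n (RWRE.shift e)) (z + x)
              + K * (Set.Ico 0 L).indicator (stayProb (Set.Ico 0 L) n (RWRE.shift e)) (z + x))
              ∂(e 0 : Measure ℝ) := by
            refine integral_mono (he.integrable_indicator_posMean hp (n + k) z)
              ((i1.const_mul _).add (i2.const_mul _)) fun x => ?_
            by_cases h : 0 < z + x
            · simp only [Set.indicator_of_mem (Set.mem_Ioi.2 h)]
              exact ih he.shift hK' h.le
            · simp only [Set.indicator_of_notMem (show z + x ∉ Set.Ioi 0 by simpa using h)]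
              have : 0 ≤ (Set.Ico 0 L).indicator (stayProb (Set.Ico 0 L) n (RWRE.shift e))
                (z + x) := Set.indicator_apply_nonneg fun _ => (stayProb_mem_Icc _ _ _ _).1
              positivity
        _ = _ := by
            rw [integral_add (i1.const_mul _) (i2.const_mul _), integral_const_mul,
              integral_const_mul]
            rfl

/-- A surviving walk either reaches height `L`, where the submartingale lower bound gives `1 ≤ z / L
≤ L⁻¹ * posMean`, or remains in `[0, L)`. -/
theorem HasMoment.stayProb_Ioi_le (he : HasMoment p e) (hp : 1 ≤ p) {L : ℝ} (hL : 0 < L) (n : ℕ)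
    {z : ℝ} (hz : 0 ≤ z) :
    stayProb (Set.Ioi 0) n e z ≤ L⁻¹ * posMean n e z
      + (Set.Ico 0 L).indicator (stayProb (Set.Ico 0 L) n e) z := by
  have hlarge : ∀ {m : ℕ} {e : Env} {z : ℝ}, HasMoment p e → 0 ≤ z → L ≤ z →
      1 ≤ L⁻¹ * posMean m e z := fun {m e z} he hz hLz => by
    have h1 := (he.posMean_bounds hp one_pos m hz).1
    rw [← div_eq_inv_mul, one_le_div hL]
    exact hLz.trans h1
  induction n generalizing e z with
  | zero =>
    by_cases hLz : L ≤ z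
    · rw [Set.indicator_of_notMem (by simp [hLz]), add_zero]
      exact hlarge he hz hLz
    · rw [Set.indicator_of_mem (Set.mem_Ico.2 ⟨hz, not_le.1 hLz⟩)]
      have : 0 ≤ L⁻¹ * z := by positivity
      simp only [posMean, stayProb, killed]
      linarith
  | succ n ih =>
    by_cases hLz : L ≤ z
    · rw [Set.indicator_of_notMem (by simp [hLz]), add_zero]
      exact (stayProb_mem_Icc _ _ _ _).2.trans (hlarge he hz hLz)
    · rw [Set.indicator_of_mem (Set.mem_Ico.2 ⟨hz, not_le.1 hLz⟩)]
      have i1 := he.integrable_indicator_posMean hp n z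
      have i2 := integrable_indicator_stayProb (measurableSet_Ico (a := 0) (b := L)) n
        (RWRE.shift e) z (e 0)
      calc stayProb (Set.Ioi 0) (n + 1) e z
          ≤ ∫ x, (L⁻¹ * (Set.Ioi 0).indicator (posMean n (RWRE.shift e)) (z + x)
              + (Set.Ico 0 L).indicator (stayProb (Set.Ico 0 L) n (RWRE.shift e)) (z + x))
              ∂(e 0 : Measure ℝ) := by
            refine integral_mono (integrable_indicator_stayProb measurableSet_Ioi n _ z _)
              ((i1.const_mul _).add i2) fun x => ?_
            by_cases h : 0 < z + x
            · simp only [Set.indicator_of_mem (Set.mem_Ioi.2 h)]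
              exact ih he.shift h.le
            · simp only [Set.indicator_of_notMem (show z + x ∉ Set.Ioi 0 by simpa using h),
                mul_zero, zero_add]
              exact Set.indicator_apply_nonneg fun _ => (stayProb_mem_Icc _ _ _ _).1
        _ = _ := by
            rw [integral_add (i1.const_mul _) i2, integral_const_mul]
            rfl

theorem HasMoment.integrable_sq (he : HasMoment p e) (hp : 2 ≤ p) (k : ℕ) :
    Integrable (fun x : ℝ => x ^ 2) (e k : Measure ℝ) := by
  refine Integrable.mono' ((integrable_const (1 : ℝ)).add (he.integrable_rpow k))
    (by fun_prop) (ae_of_all _ fun x => ?_)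
  have := rpow_le_add_mul_rpow hp zero_le_two one_pos (abs_nonneg x)
  simpa using this

/-- Supermartingale argument. One step lowers the mean of the bracket `H`, whose moment budget pays
for the jump, by the variance of the increment; as `0 ≤ H ≤ D`, this is a decay by the factor `exp
(-truncVar / D)` at least. The moment budget keeps `H` nonnegative when a large jump leaves `[0,
L)`. -/
theorem HasMoment.stayProb_Ico_le (he : HasMoment p e) (hp : 2 ≤ p) {l L D : ℝ} (hl : 0 < l)
    (hD : 0 < D) (n : ℕ)
    (hDn : 2 * L ^ 2 + 2 * l ^ 2 + 2 * l ^ (2 - p) * momentSum p n e ≤ D) {z : ℝ}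
    (hz : 0 ≤ z) (hzL : z < L) :
    L ^ 2 * stayProb (Set.Ico 0 L) n e z ≤
      (2 * L ^ 2 + 2 * l ^ 2 + 2 * l ^ (2 - p) * momentSum p n e - z ^ 2)
        * Real.exp (-(varSum n e / D)) := by
  have hlp : 0 < l ^ (2 - p) := by positivity
  induction n generalizing e z with
  | zero =>
    have : z ^ 2 ≤ L ^ 2 := by gcongr
    simp [stayProb, killed, momentSum, varSum]
    nlinarith [sq_nonneg l]
  | succ n ih =>
    have hM := momentSum_nonneg p n (RWRE.shift e)
    have hM' := momentSum_nonneg p (n + 1) e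
    have hc := absMoment_nonneg p (e 0)
    have hzL2 : z ^ 2 ≤ L ^ 2 := by gcongr
    set κ := 2 * l ^ (2 - p) with hκ
    have hκ0 : 0 < κ := by positivity
    set A := 2 * L ^ 2 + 2 * l ^ 2 with hA
    set E := Real.exp (-(varSum n (RWRE.shift e) / D)) with hE
    have hE0 : 0 < E := Real.exp_pos _
    have hD' : A + κ * momentSum p n (RWRE.shift e) ≤ D := by
      refine le_trans ?_ hDn
      rw [momentSum_succ]
      gcongr
      linarith
    obtain ⟨hi, hm⟩ := he.toIsCentered 0
    have hip := he.integrable_rpow 0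
    have hi2 := he.integrable_sq hp 0
    set H := A + κ * momentSum p (n + 1) e - z ^ 2 with hH
    have hH0 : 0 ≤ H := by
      have : 0 ≤ κ * momentSum p (n + 1) e := by positivity
      rw [hH, hA]; nlinarith [sq_nonneg l, sq_nonneg L]
    have hstep : L ^ 2 * stayProb (Set.Ico 0 L) (n + 1) e z
        ≤ E * (H - ∫ x, x ^ 2 ∂(e 0 : Measure ℝ)) := by
      calc L ^ 2 * stayProb (Set.Ico 0 L) (n + 1) e z
          = ∫ x, L ^ 2 * (Set.Ico 0 L).indicator (stayProb (Set.Ico 0 L) n (RWRE.shift e)) (z + x)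
              ∂(e 0 : Measure ℝ) := (integral_const_mul _ _).symm
        _ ≤ ∫ x, E * (((A + κ * momentSum p n (RWRE.shift e) - z ^ 2 + -(2 * z) * x)
              + κ * |x| ^ p) - x ^ 2) ∂(e 0 : Measure ℝ) := by
            refine integral_mono
              ((integrable_indicator_stayProb measurableSet_Ico n _ z _).const_mul _)
              (((((integrable_const _).add (hi.const_mul _)).add (hip.const_mul _)).sub
                hi2).const_mul _) fun x => ?_
            have hxp : 0 ≤ κ * |x| ^ p := by positivity
            by_cases h : z + x ∈ Set.Ico 0 L
            · simp only [Set.indicator_of_mem h]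
              refine (ih he.shift hD' h.1 h.2).trans ?_
              rw [mul_comm]
              refine mul_le_mul_of_nonneg_left ?_ hE0.le
              nlinarith
            · simp only [Set.indicator_of_notMem h, mul_zero]
              refine mul_nonneg hE0.le ?_
              -- On exit the majorant must be nonnegative: `(z + x)² ≤ 2 z² + 2 x²` with `z < L`
              -- explains the factors `2` in `A` and `κ`.
              have hx : x ^ 2 ≤ l ^ 2 + l ^ (2 - p) * |x| ^ p := by
                simpa using rpow_le_add_mul_rpow hp zero_le_two hl (abs_nonneg x)
              have h1 : 0 ≤ κ * momentSum p n (RWRE.shift e) := by positivity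
              have h2 : κ * |x| ^ p = 2 * (l ^ (2 - p) * |x| ^ p) := by rw [hκ]; ring
              rw [h2, hA]
              nlinarith [sq_nonneg (z - x)]
        _ = E * (H - ∫ x, x ^ 2 ∂(e 0 : Measure ℝ)) := by
            have j1 : Integrable (fun x : ℝ => A + κ * momentSum p n (RWRE.shift e) - z ^ 2
                + -(2 * z) * x) (e 0 : Measure ℝ) := (integrable_const _).add (hi.const_mul _)
            have j2 : Integrable (fun x : ℝ => A + κ * momentSum p n (RWRE.shift e) - z ^ 2
                + -(2 * z) * x + κ * |x| ^ p) (e 0 : Measure ℝ) := j1.add (hip.const_mul _)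
            rw [integral_const_mul, integral_sub j2 hi2, integral_add j1 (hip.const_mul _),
              integral_add (integrable_const _) (hi.const_mul _), integral_const_mul,
              integral_const_mul, hm, hH, momentSum_succ]
            simp only [absMoment, integral_const, probReal_univ, one_smul]; ring
    have hw0 := truncVar_nonneg (e 0)
    have hwv : truncVar (e 0) ≤ ∫ x, x ^ 2 ∂(e 0 : Measure ℝ) := min_le_left _ _
    have hHD : H ≤ D := by rw [hH]; nlinarith [sq_nonneg z]
    -- From `1 - t ≤ exp (-t)` with `t = truncVar / D`, since `H * t ≤ truncVar` when `H ≤ D`.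
    have hfin : H - ∫ x, x ^ 2 ∂(e 0 : Measure ℝ) ≤ H * Real.exp (-(truncVar (e 0) / D)) := by
      have h1 := Real.add_one_le_exp (-(truncVar (e 0) / D))
      have h2 : H * (truncVar (e 0) / D) ≤ truncVar (e 0) := by
        calc H * (truncVar (e 0) / D) ≤ D * (truncVar (e 0) / D) := by gcongr
          _ = truncVar (e 0) := by field_simp
      nlinarith [mul_le_mul_of_nonneg_left h1 hH0]
    refine hstep.trans ((mul_le_mul_of_nonneg_left hfin hE0.le).trans_eq ?_)
    rw [varSum_succ, add_div, neg_add, Real.exp_add]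
    ring

/-- When the moment sum is at most `l ^ p` and `l ≤ L`, each of the three terms of the bracket is at
most `2 L²`, whence the constant `6`. -/
theorem HasMoment.indicator_stayProb_le (he : HasMoment p e) (hp : 2 ≤ p) {l L : ℝ} (hl : 0 < l)
    (hlL : l ≤ L) (n : ℕ) (hM : momentSum p n e ≤ l ^ p) (z : ℝ) :
    (Set.Ico 0 L).indicator (stayProb (Set.Ico 0 L) n e) z
      ≤ 6 * Real.exp (-(varSum n e / (6 * L ^ 2))) := by
  have hL : 0 < L := hl.trans_le hlL
  by_cases hz : z ∈ Set.Ico 0 L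
  · rw [Set.indicator_of_mem hz]
    have h2 : l ^ (2 - p) * momentSum p n e ≤ l ^ 2 := by
      calc l ^ (2 - p) * momentSum p n e ≤ l ^ (2 - p) * l ^ p := by gcongr
        _ = l ^ 2 := by rw [← Real.rpow_add hl]; simp
    have h3 : l ^ 2 ≤ L ^ 2 := by gcongr
    have hD : 2 * L ^ 2 + 2 * l ^ 2 + 2 * l ^ (2 - p) * momentSum p n e ≤ 6 * L ^ 2 := by
      linarith
    have h := he.stayProb_Ico_le hp hl (by positivity) n hD hz.1 hz.2
    have h4 : L ^ 2 * stayProb (Set.Ico 0 L) n e z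
        ≤ L ^ 2 * (6 * Real.exp (-(varSum n e / (6 * L ^ 2)))) := by
      refine h.trans ?_
      rw [← mul_assoc, mul_comm (L ^ 2) 6]
      gcongr
      nlinarith [sq_nonneg z]
    exact le_of_mul_le_mul_left h4 (by positivity)
  · rw [Set.indicator_of_notMem hz]; positivity

theorem HasMoment.posMean_add_le_exp (he : HasMoment p e) (hp : 2 ≤ p) {l L : ℝ} (hl : 0 < l)
    (hlL : l ≤ L) (n k : ℕ) (hM : momentSum p (n + k) e ≤ l ^ p) {z : ℝ} (hz : 0 ≤ z) :
    posMean (n + k) e z ≤ (1 + 2 * l / L) * posMean n e z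
      + 12 * l * Real.exp (-(varSum n e / (6 * L ^ 2))) := by
  have hK : l + l ^ (1 - p) * momentSum p (n + k) e ≤ 2 * l := by
    have : l ^ (1 - p) * momentSum p (n + k) e ≤ l := by
      calc l ^ (1 - p) * momentSum p (n + k) e ≤ l ^ (1 - p) * l ^ p := by gcongr
        _ = l := by rw [← Real.rpow_add hl]; simp
    linarith
  refine (he.posMean_add_le (by linarith) hl (hl.trans_le hlL) n k hK hz).trans ?_
  have h1 := he.indicator_stayProb_le hp hl hlL n
    ((momentSum_mono p e (Nat.le_add_right n k)).trans hM) z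
  have h2 := mul_le_mul_of_nonneg_left h1 (show 0 ≤ 2 * l by positivity)
  linarith

theorem HasMoment.stayProb_Ioi_le_exp (he : HasMoment p e) (hp : 2 ≤ p) {l L : ℝ} (hl : 0 < l)
    (hlL : l ≤ L) (n : ℕ) (hM : momentSum p n e ≤ l ^ p) {z : ℝ} (hz : 0 ≤ z) :
    stayProb (Set.Ioi 0) n e z ≤ L⁻¹ * posMean n e z
      + 6 * Real.exp (-(varSum n e / (6 * L ^ 2))) :=
  (he.stayProb_Ioi_le (by linarith) (hl.trans_le hlL) n hz).trans
    (by gcongr; exact he.indicator_stayProb_le hp hl hlL n hM z)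

end

/-! ### Growth of sums along orbits of a measure preserving map. -/

section MeasurePreserving

variable {X : Type*} [MeasurableSpace X] {Q : Measure X}

theorem ae_tendsto_zero_of_summable_integral {g : ℕ → X → ℝ} {u : ℕ → ℝ}
    (hg : ∀ j, Integrable (g j) Q) (hg0 : ∀ j x, 0 ≤ g j x) (hgu : ∀ j, ∫ x, g j x ∂Q ≤ u j)
    (hu : Summable u) : ∀ᵐ x ∂Q, Tendsto (fun j => g j x) atTop (𝓝 0) := by
  have hm : ∀ j, AEMeasurable (fun x => ENNReal.ofReal (g j x)) Q := fun j =>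
    (hg j).1.aemeasurable.ennreal_ofReal
  have hfin : ∫⁻ x, ∑' j, ENNReal.ofReal (g j x) ∂Q ≠ ⊤ := by
    rw [lintegral_tsum hm]
    refine ne_top_of_le_ne_top hu.tsum_ofReal_ne_top (ENNReal.tsum_le_tsum fun j => ?_)
    rw [← ofReal_integral_eq_lintegral_ofReal (hg j) (ae_of_all _ (hg0 j))]
    exact ENNReal.ofReal_le_ofReal (hgu j)
  filter_upwards [ae_lt_top' (AEMeasurable.tsum hm) hfin] with x hx
  have h := ENNReal.tendsto_atTop_zero_of_tsum_ne_top hx.ne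
  have h' := (ENNReal.tendsto_toReal ENNReal.zero_ne_top).comp h
  simpa [Function.comp_def, fun j => ENNReal.toReal_ofReal (hg0 j x)] using h'

/-- The partial sums of `a` satisfy `∑ aₖ / (1 + aₖ + ⋯ + aₖ₊ₙ₋₁) ≤ log (1 + ∑ aₖ)`. -/
theorem sum_div_one_add_sum_le_log {a : ℕ → ℝ} (ha : ∀ k, 0 ≤ a k) {n N : ℕ} (hn : n ≤ N) :
    ∑ k ∈ Finset.range n, a k / (1 + ∑ i ∈ Finset.range N, a (k + i))
      ≤ Real.log (1 + ∑ i ∈ Finset.range n, a i) := by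
  induction n generalizing a with
  | zero => simp
  | succ n ih =>
    have h := ih (a := fun k => a (k + 1)) (fun k => ha _) (by omega)
    rw [Finset.sum_range_succ', Finset.sum_range_succ' (fun i => a i)]
    simp only [Nat.zero_add]
    set s := ∑ i ∈ Finset.range n, a (i + 1) with hs
    have hs0 : 0 ≤ s := Finset.sum_nonneg fun i _ => ha _
    have h1 : s + a 0 ≤ ∑ i ∈ Finset.range N, a i := by
      rw [hs, ← Finset.sum_range_succ' (fun i => a i)]
      exact Finset.sum_le_sum_of_subset_of_nonneg (Finset.range_subset_range.2 hn)
        fun i _ _ => ha i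
    have h2 : a 0 / (1 + ∑ i ∈ Finset.range N, a i) ≤ a 0 / (1 + (s + a 0)) := by
      have := ha 0
      gcongr
    -- This is `1 - 1 / t ≤ log t` for the ratio `t` of consecutive sums; summing over the tails
    -- telescopes.
    have h3 : a 0 / (1 + (s + a 0)) ≤ Real.log (1 + (s + a 0)) - Real.log (1 + s) := by
      have := ha 0
      have hlog := Real.one_sub_inv_le_log_of_pos (x := (1 + (s + a 0)) / (1 + s)) (by positivity)
      rw [Real.log_div (by positivity) (by positivity)] at hlog
      refine le_trans (le_of_eq ?_) hlog
      field_simp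
      ring
    have h4 : ∀ k, ∑ i ∈ Finset.range N, a (k + 1 + i) = ∑ i ∈ Finset.range N, a (k + i + 1) :=
      fun k => Finset.sum_congr rfl fun i _ => by ring_nf
    simp only [h4]
    linarith

variable {T : X → X}

/-- Divided by `2 ^ (j (1 + γ))`, the sum has mean `2 (∫ f) 2 ^ (-γ j)`, which is summable in `j`,
so the ratios tend to `0` a.e. -/
theorem ae_eventually_sum_iterate_le (hT : MeasurePreserving T Q Q) {f : X → ℝ}
    (hf : Integrable f Q) (hf0 : ∀ x, 0 ≤ f x) {γ : ℝ} (hγ : 0 < γ) :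
    ∀ᵐ x ∂Q, ∀ᶠ j : ℕ in atTop,
      ∑ k ∈ Finset.range (2 ^ (j + 1)), f (T^[k] x) ≤ ((2 : ℝ) ^ j) ^ (1 + γ) := by
  have hfk : ∀ k, Integrable (fun x => f (T^[k] x)) Q := fun k =>
    (hT.iterate k).integrable_comp_of_integrable hf
  have hik : ∀ k, ∫ x, f (T^[k] x) ∂Q = ∫ x, f x ∂Q := fun k => by
    have h := hT.iterate k
    have h2 : AEStronglyMeasurable f (Q.map T^[k]) := by rw [h.map_eq]; exact hf.1
    rw [← integral_map h.aemeasurable h2, h.map_eq]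
  have h := ae_tendsto_zero_of_summable_integral (Q := Q)
    (g := fun j x => (∑ k ∈ Finset.range (2 ^ (j + 1)), f (T^[k] x)) / ((2 : ℝ) ^ j) ^ (1 + γ))
    (u := fun j => 2 * (∫ x, f x ∂Q) * ((2 : ℝ) ^ (-γ)) ^ j)
    (fun j => (integrable_finsetSum _ fun k _ => hfk k).div_const _)
    (fun j x => div_nonneg (Finset.sum_nonneg fun k _ => hf0 _) (by positivity)) (fun j => ?_)
    ((summable_geometric_of_lt_one (by positivity)
      (Real.rpow_lt_one_of_one_lt_of_neg one_lt_two (by linarith))).mul_left _)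
  · filter_upwards [h] with x hx
    filter_upwards [hx.eventually (gt_mem_nhds one_pos)] with j hj
    exact ((div_lt_one (by positivity)).1 hj).le
  · rw [integral_div, integral_finsetSum _ fun k _ => hfk k]
    simp only [hik, Finset.sum_const, Finset.card_range, nsmul_eq_mul]
    refine le_of_eq ?_
    rw [Real.rpow_add (by positivity), Real.rpow_one, ← Real.rpow_natCast 2 j,
      ← Real.rpow_natCast (2 ^ (-γ)) j, ← Real.rpow_mul (by norm_num),
      ← Real.rpow_mul (by norm_num)]
    rw [show -γ * (j : ℝ) = -(j * γ) by ring, Real.rpow_neg (by norm_num)]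
    push_cast
    rw [pow_succ, Real.rpow_natCast]
    field_simp

/-- By invariance, `N` times the integral is the integral of the sum of the ratio over `N` orbit
points, to which the pointwise logarithmic bound applies. -/
theorem integral_div_one_add_sum_iterate_le [IsProbabilityMeasure Q] (hT : MeasurePreserving T Q Q)
    {w : X → ℝ} (hw : Measurable w) (hw0 : ∀ x, 0 ≤ w x) (hw1 : ∀ x, w x ≤ 1) (N : ℕ) :
    Integrable (fun x => w x / (1 + ∑ k ∈ Finset.range N, w (T^[k] x))) Q ∧
    N * ∫ x, w x / (1 + ∑ k ∈ Finset.range N, w (T^[k] x)) ∂Q ≤ Real.log (1 + N) := by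
  set G : X → ℝ := fun x => w x / (1 + ∑ k ∈ Finset.range N, w (T^[k] x)) with hG
  have hGm : Measurable G := hw.div (measurable_const.add
    (Finset.measurable_fun_sum _ fun k _ => hw.comp (hT.measurable.iterate k)))
  have hS0 : ∀ x, 0 ≤ ∑ k ∈ Finset.range N, w (T^[k] x) := fun x =>
    Finset.sum_nonneg fun k _ => hw0 _
  have hG0 : ∀ x, 0 ≤ G x := fun x => div_nonneg (hw0 x) (by linarith [hS0 x])
  have hG1 : ∀ x, G x ≤ 1 := fun x =>
    div_le_one_of_le₀ (by linarith [hS0 x, hw1 x]) (by linarith [hS0 x])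
  have hGi : Integrable G Q := Integrable.mono' (integrable_const (1 : ℝ))
    hGm.aestronglyMeasurable
    (ae_of_all _ fun x => by rw [Real.norm_of_nonneg (hG0 x)]; exact hG1 x)
  refine ⟨hGi, ?_⟩
  have hGk : ∀ k, Integrable (fun x => G (T^[k] x)) Q := fun k =>
    (hT.iterate k).integrable_comp_of_integrable hGi
  have hik : ∀ k, ∫ x, G (T^[k] x) ∂Q = ∫ x, G x ∂Q := fun k => by
    have h := hT.iterate k
    rw [← integral_map h.aemeasurable hGm.aestronglyMeasurable, h.map_eq]
  calc N * ∫ x, G x ∂Q = ∫ x, ∑ k ∈ Finset.range N, G (T^[k] x) ∂Q := by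
        rw [integral_finsetSum _ fun k _ => hGk k]
        simp [hik]
    _ ≤ ∫ _, Real.log (1 + N) ∂Q := by
        refine integral_mono (integrable_finsetSum _ fun k _ => hGk k) (integrable_const _)
          fun x => ?_
        have h := sum_div_one_add_sum_le_log (a := fun k => w (T^[k] x)) (fun k => hw0 _) le_rfl
          (N := N)
        have h2 : ∑ k ∈ Finset.range N, G (T^[k] x) = ∑ k ∈ Finset.range N,
            w (T^[k] x) / (1 + ∑ i ∈ Finset.range N, w (T^[k + i] x)) := by
          refine Finset.sum_congr rfl fun k _ => ?_
          simp only [hG, ← Function.iterate_add_apply]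
          simp only [add_comm]
        simp only [h2]
        refine h.trans (Real.log_le_log (by linarith [hS0 x]) ?_)
        have : ∑ k ∈ Finset.range N, w (T^[k] x) ≤ ∑ k ∈ Finset.range N, (1 : ℝ) :=
          Finset.sum_le_sum fun k _ => hw1 _
        simp at this
        linarith
    _ = Real.log (1 + N) := by simp

/-- With `N = 2 ^ j`, the mean of `N ^ (1 - δ) * w / (1 + S_N)` is at most `N ^ (-δ) * log (1 + N)`,
summable in `j`. So this ratio eventually drops below `w x > 0`, and cancelling `w x` gives the
lower bound. -/
theorem ae_eventually_le_sum_iterate [IsProbabilityMeasure Q] (hT : MeasurePreserving T Q Q)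
    {w : X → ℝ} (hw : Measurable w) (hw0 : ∀ x, 0 ≤ w x) (hw1 : ∀ x, w x ≤ 1) {δ : ℝ} (hδ : 0 < δ) :
    ∀ᵐ x ∂Q, 0 < w x → ∀ᶠ j : ℕ in atTop,
      ((2 : ℝ) ^ j) ^ (1 - δ) ≤ 1 + ∑ k ∈ Finset.range (2 ^ j), w (T^[k] x) := by
  have hr : (2 : ℝ) ^ (-δ) < 1 := Real.rpow_lt_one_of_one_lt_of_neg one_lt_two (by linarith)
  have hr0 : 0 < (2 : ℝ) ^ (-δ) := by positivity
  have hS0 : ∀ (n : ℕ) x, 0 ≤ ∑ k ∈ Finset.range n, w (T^[k] x) := fun n x =>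
    Finset.sum_nonneg fun k _ => hw0 _
  have hsum : Summable fun j : ℕ => (j : ℝ) * ((2 : ℝ) ^ (-δ)) ^ j := by
    simpa using summable_pow_mul_geometric_of_norm_lt_one 1 (r := (2 : ℝ) ^ (-δ))
      (by rwa [Real.norm_of_nonneg hr0.le])
  have h := ae_tendsto_zero_of_summable_integral (Q := Q)
    (g := fun j x => ((2 : ℝ) ^ j) ^ (1 - δ) *
      (w x / (1 + ∑ k ∈ Finset.range (2 ^ j), w (T^[k] x))))
    (u := fun j => (j : ℝ) * ((2 : ℝ) ^ (-δ)) ^ j + ((2 : ℝ) ^ (-δ)) ^ j)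
    (fun j => (integral_div_one_add_sum_iterate_le hT hw hw0 hw1 (2 ^ j)).1.const_mul _)
    (fun j x => mul_nonneg (by positivity)
      (div_nonneg (hw0 x) (by linarith [hS0 (2 ^ j) x]))) (fun j => ?_)
    (hsum.add (summable_geometric_of_lt_one hr0.le hr))
  · filter_upwards [h] with x hx hpos
    filter_upwards [hx.eventually (gt_mem_nhds hpos)] with j hj
    have hS := hS0 (2 ^ j) x
    rw [mul_div_assoc', div_lt_iff₀ (by linarith), mul_comm] at hj
    exact (lt_of_mul_lt_mul_left hj hpos.le).le
  · have h1 := (integral_div_one_add_sum_iterate_le hT hw hw0 hw1 (2 ^ j)).2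
    rw [integral_const_mul]
    push_cast at h1
    have h2 : Real.log (1 + 2 ^ j) ≤ j + 1 := by
      calc Real.log (1 + 2 ^ j) ≤ Real.log (2 ^ (j + 1)) := by
            refine Real.log_le_log (by positivity) ?_
            have : (1 : ℝ) ≤ 2 ^ j := one_le_pow₀ one_le_two
            rw [pow_succ]; linarith
        _ = (j + 1) * Real.log 2 := by rw [Real.log_pow]; push_cast; ring
        _ ≤ (j + 1) * 1 := by
            gcongr
            linarith [Real.log_two_lt_d9]
        _ = j + 1 := mul_one _
    have h3 : ((2 : ℝ) ^ j) ^ (1 - δ) = ((2 : ℝ) ^ (-δ)) ^ j * 2 ^ j := by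
      rw [sub_eq_add_neg, Real.rpow_add (by positivity), Real.rpow_one, mul_comm,
        ← Real.rpow_natCast 2 j, ← Real.rpow_natCast (2 ^ (-δ)) j, ← Real.rpow_mul (by norm_num),
        ← Real.rpow_mul (by norm_num), mul_comm (j : ℝ)]
    rw [h3, mul_assoc]
    calc _ ≤ ((2 : ℝ) ^ (-δ)) ^ j * (j + 1) := by
          gcongr
          exact h1.trans h2
      _ = _ := by ring

end MeasurePreserving

/-! ### The dyadic recursion and the choice of scales. -/

theorem exists_le_of_succ_le {a r : ℕ → ℝ} (hr : Summable r) (hr0 : ∀ j, 0 ≤ r j)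
    (ha0 : ∀ j, 0 ≤ a j) {J : ℕ} (ha : ∀ j ≥ J, a (j + 1) ≤ (1 + r j) * a j + r j) :
    ∃ C, ∀ j ≥ J, a j ≤ C := by
  refine ⟨(a J + 1) * Real.exp (∑' j, r j), fun j hj => ?_⟩
  -- Adding `1` makes the recursion purely multiplicative: `a (j + 1) + 1 ≤ (1 + r j) * (a j + 1)`.
  have key : a j + 1 ≤ (a J + 1) * Real.exp (∑ i ∈ Finset.Ico J j, r i) := by
    induction j, hj using Nat.le_induction with
    | base => simp
    | succ j hj ih =>
      rw [Finset.sum_Ico_succ_top hj, Real.exp_add, ← mul_assoc]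
      have h1 := ha j hj
      have h2 := Real.add_one_le_exp (r j)
      calc a (j + 1) + 1 ≤ (a j + 1) * (r j + 1) := by linarith
        _ ≤ _ := by
          have := ha0 j
          have := hr0 j
          have := ha0 J
          gcongr
  have h3 : ∑ i ∈ Finset.Ico J j, r i ≤ ∑' j, r j := hr.sum_le_tsum _ fun i _ => hr0 i
  have h4 : (a J + 1) * Real.exp (∑ i ∈ Finset.Ico J j, r i)
      ≤ (a J + 1) * Real.exp (∑' j, r j) := by
    have := ha0 J
    gcongr
  linarith

theorem tendsto_mul_exp_neg_rpow {δ : ℝ} (hδ : 0 < δ) :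
    Tendsto (fun x : ℝ => x * Real.exp (1 - x ^ δ / 6)) atTop (𝓝 0) := by
  have h := (tendsto_rpow_mul_exp_neg_mul_atTop_nhds_zero δ⁻¹ (1 / 6) (by norm_num)).comp
    (tendsto_rpow_atTop hδ)
  have h' := h.const_mul (Real.exp 1)
  rw [mul_zero] at h'
  refine h'.congr' ?_
  filter_upwards [eventually_ge_atTop 0] with x hx
  simp only [Function.comp_apply]
  rw [← Real.rpow_mul hx, mul_inv_cancel₀ hδ.ne', Real.rpow_one, sub_eq_add_neg, Real.exp_add,
    show -(1 / 6) * x ^ δ = -(x ^ δ / 6) by ring]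
  ring

/-- With `L = N ^ (1/2 - δ)` the variance exceeds `L²` by a factor of order `N ^ δ`; the `1` in the
exponent absorbs the `1` in `hV`. -/
theorem exp_neg_div_le {N δ V : ℝ} (hN : 1 ≤ N) (hδ : δ ≤ 1 / 4) (hV : N ^ (1 - δ) ≤ 1 + V) :
    Real.exp (-(V / (6 * (N ^ (1 / 2 - δ)) ^ 2))) ≤ Real.exp (1 - N ^ δ / 6) := by
  have hN0 : 0 < N := by linarith
  have h1 : (N ^ (1 / 2 - δ)) ^ 2 = N ^ (1 - 2 * δ) := by
    rw [← Real.rpow_natCast, ← Real.rpow_mul hN0.le]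
    congr 1
    push_cast; ring
  have h2 : N ^ (1 - δ) = N ^ δ * N ^ (1 - 2 * δ) := by
    rw [← Real.rpow_add hN0]; congr 1; ring
  have h3 : 1 ≤ N ^ (1 - 2 * δ) := Real.one_le_rpow hN (by linarith)
  refine Real.exp_le_exp.2 ?_
  rw [h1]
  have h4 : N ^ δ / 6 - 1 ≤ V / (6 * N ^ (1 - 2 * δ)) := by
    rw [le_div_iff₀ (by positivity)]
    nlinarith
  linarith

section Quenched

variable {p γ δ : ℝ} {e : Env}

/-- Bounds on the growth of the moments and the variances along dyadic times. -/
structure HasGrowth (p γ δ : ℝ) (e : Env) : Prop where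
  moment_le : ∀ᶠ j : ℕ in atTop, momentSum p (2 ^ (j + 1)) e ≤ ((2 : ℝ) ^ j) ^ (1 + γ)
  le_var : ∀ᶠ j : ℕ in atTop, ((2 : ℝ) ^ j) ^ (1 - δ) ≤ 1 + varSum (2 ^ j) e

theorem rpow_scale (hγ : (1 / 2 - 2 * δ) * p = 1 + γ) {N : ℝ} (hN : 0 ≤ N) :
    (N ^ (1 / 2 - 2 * δ)) ^ p = N ^ (1 + γ) := by
  rw [← Real.rpow_mul hN, hγ]

/-- The relation `hγ` makes `l ^ p` equal to the moment bound `N ^ (1 + γ)`, while `l / L = N ^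
(-δ)` is geometric in `j`. -/
theorem HasMoment.exists_posMean_le (he : HasMoment p e) (hg : HasGrowth p γ δ e) (hp : 2 ≤ p)
    (hδ0 : 0 < δ) (hδ : δ ≤ 1 / 8) (hγ : (1 / 2 - 2 * δ) * p = 1 + γ) {z : ℝ} (hz : 0 ≤ z) :
    ∃ C, ∀ᶠ j : ℕ in atTop, posMean (2 ^ j) e z ≤ C := by
  have hN : ∀ j : ℕ, (1 : ℝ) ≤ 2 ^ j := fun j => one_le_pow₀ one_le_two
  have hlim := (tendsto_mul_exp_neg_rpow hδ0).comp
    (tendsto_pow_atTop_atTop_of_one_lt (one_lt_two (α := ℝ)))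
  have hstep : ∀ᶠ j : ℕ in atTop, posMean (2 ^ (j + 1)) e z
      ≤ (1 + 2 * ((2 : ℝ) ^ (-δ)) ^ j) * posMean (2 ^ j) e z + 2 * ((2 : ℝ) ^ (-δ)) ^ j := by
    filter_upwards [hg.moment_le, hg.le_var,
      hlim.eventually (gt_mem_nhds (show (0 : ℝ) < 1 / 6 by norm_num))] with j h1 h2 h3
    set N : ℝ := 2 ^ j with hNdef
    have hN1 := hN j
    have hN0 : 0 < N := by positivity
    have hl : 0 < N ^ (1 / 2 - 2 * δ) := by positivity
    have hL : 0 < N ^ (1 / 2 - δ) := by positivity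
    have hlL : N ^ (1 / 2 - 2 * δ) ≤ N ^ (1 / 2 - δ) :=
      Real.rpow_le_rpow_of_exponent_le hN1 (by linarith)
    have hrat : N ^ (1 / 2 - 2 * δ) = ((2 : ℝ) ^ (-δ)) ^ j * N ^ (1 / 2 - δ) := by
      have : ((2 : ℝ) ^ (-δ)) ^ j = N ^ (-δ) := by
        rw [hNdef, ← Real.rpow_natCast, ← Real.rpow_natCast, ← Real.rpow_mul (by norm_num),
          ← Real.rpow_mul (by norm_num), mul_comm]
      rw [this, ← Real.rpow_add hN0]; congr 1; ring
    rw [pow_succ, mul_two] at h1 ⊢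
    have h := he.posMean_add_le_exp hp hl hlL (2 ^ j) (2 ^ j)
      (by rw [rpow_scale hγ hN0.le]; exact h1) hz
    have hexp := exp_neg_div_le hN1 (by linarith) h2
    have hLN : N ^ (1 / 2 - δ) ≤ N := by
      calc N ^ (1 / 2 - δ) ≤ N ^ (1 : ℝ) := Real.rpow_le_rpow_of_exponent_le hN1 (by linarith)
        _ = N := Real.rpow_one N
    set E := Real.exp (-(varSum (2 ^ j) e / (6 * (N ^ (1 / 2 - δ)) ^ 2))) with hE
    -- Since `l = 2 ^ (-δ j) * L`, this turns the additive error `12 * l * E` into at most `2 * 2 ^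
    -- (-δ j)`.
    have hLE : N ^ (1 / 2 - δ) * E ≤ 1 / 6 := by
      calc N ^ (1 / 2 - δ) * E ≤ N * Real.exp (1 - N ^ δ / 6) := by gcongr
        _ ≤ 1 / 6 := le_of_lt h3
    refine h.trans (add_le_add (le_of_eq ?_) ?_)
    · congr 2
      rw [hrat]; field_simp
    · rw [hrat]
      have hr : 0 ≤ ((2 : ℝ) ^ (-δ)) ^ j := by positivity
      nlinarith [mul_le_mul_of_nonneg_left hLE hr]
  obtain ⟨J, hJ⟩ := eventually_atTop.1 hstep
  have hr : Summable fun j : ℕ => 2 * ((2 : ℝ) ^ (-δ)) ^ j :=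
    (summable_geometric_of_lt_one (by positivity)
      (Real.rpow_lt_one_of_one_lt_of_neg one_lt_two (by linarith))).mul_left _
  obtain ⟨C, hC⟩ := exists_le_of_succ_le (a := fun j => posMean (2 ^ j) e z) hr
    (fun j => by positivity)
    (fun j => hz.trans (he.posMean_bounds (by linarith) one_pos _ hz).1) hJ
  exact ⟨C, eventually_atTop.2 ⟨J, hC⟩⟩

theorem HasMoment.tendsto_Un (he : HasMoment p e) (hg : HasGrowth p γ δ e) (hp : 2 ≤ p)
    (hδ0 : 0 < δ) (hδ : δ ≤ 1 / 8) (hγ : (1 / 2 - 2 * δ) * p = 1 + γ) {y : ℝ} (hy : 0 ≤ y) :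
    (∀ᵐ x ∂(quenched e), tau y x < ⊤) ∧ Integrable (walkAtTau y) (quenched e) ∧
      Tendsto (fun n : ℕ => Un n e y) atTop (𝓝 (U e y)) := by
  obtain ⟨C, hC⟩ := he.exists_posMean_le hg hp hδ0 hδ hγ hy
  have hc := he.toIsCentered
  have hN : ∀ j : ℕ, (1 : ℝ) ≤ 2 ^ j := fun j => one_le_pow₀ one_le_two
  have hpow := tendsto_pow_atTop_atTop_of_one_lt (one_lt_two (α := ℝ))
  have hUn : ∀ n, Un n e y = posMean n e y := fun n =>
    hc.setIntegral_lt_tau measurable_id (fun z => by simp) y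
  -- Monotonicity in `n` carries the bound from large dyadic times to all times.
  have hbdd : ∀ n, Un n e y ≤ C := fun n => by
    obtain ⟨j, hj, hnj⟩ := (hC.and (eventually_ge_atTop n)).exists
    refine (hc.monotone_Un y (hnj.trans Nat.lt_two_pow_self.le)).trans ?_
    simp only [hUn]
    exact hj
  have htau : ∀ᵐ x ∂(quenched e), tau y x < ⊤ := by
    have hu : Tendsto (fun j : ℕ => ((2 : ℝ) ^ j) ^ (-(1 / 2 - δ)) * C
        + 6 * ((2 : ℝ) ^ j * Real.exp (1 - ((2 : ℝ) ^ j) ^ δ / 6))) atTop (𝓝 0) := by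
      have h1 := ((tendsto_rpow_neg_atTop (show 0 < 1 / 2 - δ by linarith)).comp hpow).mul_const C
      have h2 := ((tendsto_mul_exp_neg_rpow hδ0).comp hpow).const_mul 6
      simpa using h1.add h2
    refine ae_tau_lt_top hu (fun j => 2 ^ j) ?_
    filter_upwards [hg.moment_le, hg.le_var, hC] with j h1 h2 h3
    have hN1 := hN j
    have hN0 : (0 : ℝ) < 2 ^ j := by positivity
    have hprob : (quenched e).real {x | ((2 ^ j : ℕ) : WithTop ℕ) < tau y x}
        = stayProb (Set.Ioi 0) (2 ^ j) e y := by
      rw [stayProb, ← hc.setIntegral_lt_tau measurable_const (fun z => by simp) y]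
      simp
    rw [hprob]
    have h := he.stayProb_Ioi_le_exp hp (l := ((2 : ℝ) ^ j) ^ (1 / 2 - 2 * δ))
      (L := ((2 : ℝ) ^ j) ^ (1 / 2 - δ)) (by positivity)
      (Real.rpow_le_rpow_of_exponent_le hN1 (by linarith)) (2 ^ j)
      (by
        rw [rpow_scale hγ hN0.le]
        exact (momentSum_mono p e (Nat.pow_le_pow_right two_pos j.le_succ)).trans h1) hy
    refine h.trans (add_le_add ?_ ?_)
    · rw [Real.rpow_neg hN0.le]
      gcongr
    · have hexp := exp_neg_div_le hN1 (by linarith) h2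
      have := Real.exp_pos (1 - ((2 : ℝ) ^ j) ^ δ / 6)
      nlinarith
  exact ⟨htau, hc.tendsto_Un hbdd htau⟩

end Quenched

/-! ### Typical environments satisfy the moment and growth bounds. -/

section Environment

theorem shift_iterate_apply (k n : ℕ) (e : Env) : shift^[k] e n = e (n + k) := by
  induction k generalizing e with
  | zero => rfl
  | succ k ih => rw [Function.iterate_succ_apply, ih, shift]; congr 1

theorem measurable_lintegral_coe {f : ℝ → ENNReal} (hf : Measurable f) :
    Measurable fun μ : ProbabilityMeasure ℝ => ∫⁻ x, f x ∂(μ : Measure ℝ) :=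
  (Measure.measurable_lintegral hf).comp measurable_subtype_coe

theorem measurable_integral_coe {f : ℝ → ℝ} (hf : Measurable f) :
    Measurable fun μ : ProbabilityMeasure ℝ => ∫ x, f x ∂(μ : Measure ℝ) :=
  (hf.stronglyMeasurable.integral_kernel
    (κ := (⟨fun μ : ProbabilityMeasure ℝ => (μ : Measure ℝ), measurable_subtype_coe⟩ :
      Kernel (ProbabilityMeasure ℝ) ℝ))).measurable

theorem measurable_truncVar : Measurable truncVar :=
  (measurable_integral_coe (measurable_id.pow_const 2)).min measurable_const

theorem enorm_rpow_eq_ofReal {p : ℝ} (hp : 0 ≤ p) (x : ℝ) :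
    ‖x‖ₑ ^ p = ENNReal.ofReal (|x| ^ p) := by
  rw [← ofReal_norm, Real.norm_eq_abs, ENNReal.ofReal_rpow_of_nonneg (abs_nonneg x) hp]

theorem absMoment_eq_toReal {p : ℝ} (hp : 0 ≤ p) (μ : ProbabilityMeasure ℝ) :
    absMoment p μ = (∫⁻ x, ‖x‖ₑ ^ p ∂(μ : Measure ℝ)).toReal := by
  rw [absMoment, integral_eq_lintegral_of_nonneg_ae (ae_of_all _ fun x => by positivity)
    (by fun_prop)]
  simp_rw [enorm_rpow_eq_ofReal hp]

theorem integrable_rpow_of_lintegral_lt_top {p : ℝ} (hp : 0 ≤ p) {μ : ProbabilityMeasure ℝ}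
    (h : ∫⁻ x, ‖x‖ₑ ^ p ∂(μ : Measure ℝ) < ⊤) :
    Integrable (fun x : ℝ => |x| ^ p) (μ : Measure ℝ) := by
  refine ⟨by fun_prop, ?_⟩
  rw [hasFiniteIntegral_iff_ofReal (ae_of_all _ fun x => by positivity)]
  simpa only [enorm_rpow_eq_ofReal hp] using h

theorem integrable_of_integrable_rpow {p : ℝ} (hp : 1 ≤ p) {μ : ProbabilityMeasure ℝ}
    (h : Integrable (fun x : ℝ => |x| ^ p) (μ : Measure ℝ)) :
    Integrable (fun x : ℝ => x) (μ : Measure ℝ) := by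
  refine Integrable.mono' ((integrable_const (1 : ℝ)).add h) (by fun_prop)
    (ae_of_all _ fun x => ?_)
  simpa using rpow_le_add_mul_rpow hp zero_le_one one_pos (abs_nonneg x)

theorem truncVar_pos {μ : ProbabilityMeasure ℝ}
    (hi : Integrable (fun x : ℝ => x ^ 2) (μ : Measure ℝ))
    (hpos : 0 < (μ : Measure ℝ) (Set.Ioi 0)) : 0 < truncVar μ := by
  refine lt_min ((integral_pos_iff_support_of_nonneg (fun x => sq_nonneg x) hi).2 ?_) one_pos
  refine hpos.trans_le (measure_mono fun x hx => ?_)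
  simpa using (Set.mem_Ioi.1 hx).ne'

/-- Invariance carries the mean and moment conditions from time `0` to all times. Positivity of the
truncated variance is needed at time `0` only, as the starting value in the lower bound along the
orbit. -/
theorem ae_hasMoment_and_hasGrowth {Q : Measure Env} [IsProbabilityMeasure Q]
    (hT : MeasurePreserving shift Q Q) {p : ℝ} (hp : 2 ≤ p)
    (hmean : ∀ᵐ e ∂Q, ∫ x, x ∂(e 0 : Measure ℝ) = 0)
    (hmom : ∫⁻ e, ∫⁻ x, ‖x‖ₑ ^ p ∂(e 0 : Measure ℝ) ∂Q < ⊤)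
    (hpos : ∀ᵐ e ∂Q, 0 < (e 0 : Measure ℝ) (Set.Ioi 0)) {γ δ : ℝ} (hγ : 0 < γ) (hδ : 0 < δ) :
    ∀ᵐ e ∂Q, HasMoment p e ∧ HasGrowth p γ δ e := by
  have hp0 : 0 ≤ p := by linarith
  have hm : Measurable fun e : Env => ∫⁻ x, ‖x‖ₑ ^ p ∂(e 0 : Measure ℝ) :=
    (measurable_lintegral_coe (by fun_prop)).comp (measurable_pi_apply 0)
  have hall : ∀ {q : ProbabilityMeasure ℝ → Prop}, (∀ᵐ e ∂Q, q (e 0)) →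
      ∀ᵐ e ∂Q, ∀ k, q (e k) := fun {q} h => ae_all_iff.2 fun k => by
    filter_upwards [(hT.iterate k).quasiMeasurePreserving.ae h] with e he
    simpa [shift_iterate_apply] using he
  have hfin : ∀ᵐ e ∂Q, ∫⁻ x, ‖x‖ₑ ^ p ∂(e 0 : Measure ℝ) < ⊤ := ae_lt_top hm hmom.ne
  have hint : Integrable (fun e : Env => absMoment p (e 0)) Q := by
    simp_rw [absMoment_eq_toReal hp0]
    exact integrable_toReal_of_lintegral_ne_top hm.aemeasurable hmom.ne
  have hup := ae_eventually_sum_iterate_le hT hint (fun e => absMoment_nonneg _ _) hγ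
  have hlow := ae_eventually_le_sum_iterate hT (w := fun e : Env => truncVar (e 0))
    (measurable_truncVar.comp (measurable_pi_apply 0)) (fun e => truncVar_nonneg _)
    (fun e => min_le_right _ _) hδ
  filter_upwards [hall (q := fun μ => ∫ x, x ∂(μ : Measure ℝ) = 0) hmean,
    hall (q := fun μ => ∫⁻ x, ‖x‖ₑ ^ p ∂(μ : Measure ℝ) < ⊤) hfin, hpos, hup,
    hlow] with e h1 h2 h3 h4 h5
  have hip := fun k => integrable_rpow_of_lintegral_lt_top hp0 (h2 k)
  have he : HasMoment p e :=
    ⟨fun k => ⟨integrable_of_integrable_rpow (by linarith) (hip k), h1 k⟩, hip⟩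
  refine ⟨he, ?_, ?_⟩
  · simpa only [shift_iterate_apply, zero_add, momentSum] using h4
  · simpa only [shift_iterate_apply, zero_add, varSum] using
      h5 (truncVar_pos (he.integrable_sq hp 0) h3)

end Environment

end RWRE

/-! ### Transfer to the law of the environment, and conclusion. -/

theorem mainTheorem3 {Ω : Type*} [MeasurableSpace Ω] (P : Measure Ω) [IsProbabilityMeasure P]
    (ξ : Ω → RWRE.Env) (hξ : Measurable ξ) (herg : RWRE.IsStationaryErgodic P ξ)
    (hmean : ∀ᵐ ω ∂P, ∫ x, x 0 ∂(RWRE.quenched (ξ ω)) = 0)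
    (hmom : ∃ ε : ℝ, 0 < ε ∧ ∫⁻ p, ‖p.2 0‖ₑ ^ (2 + ε) ∂(RWRE.annealed P ξ hξ) < ⊤)
    (hpos : ∀ᵐ ω ∂P, 0 < RWRE.quenched (ξ ω) {x | 0 < x 0}) :
    (∀ y : ℝ, 0 ≤ y → Measurable fun e : RWRE.Env => RWRE.U e y) ∧
    ∀ᵐ ω ∂P,
      (∀ n : ℕ, Integrable (RWRE.walk n) (RWRE.quenched (ξ ω))) ∧
      ∀ y : ℝ, 0 ≤ y →
        (∀ᵐ x ∂(RWRE.quenched (ξ ω)), RWRE.tau y x < ⊤) ∧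
        Integrable (RWRE.walkAtTau y) (RWRE.quenched (ξ ω)) ∧
        Tendsto (fun n : ℕ => RWRE.Un n (ξ ω) y) atTop (𝓝 (RWRE.U (ξ ω) y)) := by
  refine ⟨fun y _ => RWRE.measurable_U y, ?_⟩
  obtain ⟨ε, hε, hmom⟩ := hmom
  have heval := RWRE.measurePreserving_eval_quenched
  have := Measure.isProbabilityMeasure_map (μ := P) hξ.aemeasurable
  have hmean' : ∀ᵐ e ∂(P.map ξ), ∫ x, x ∂(e 0 : Measure ℝ) = 0 := by
    refine (ae_map_iff hξ.aemeasurable (measurableSet_eq_fun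
      ((RWRE.measurable_integral_coe measurable_id).comp (measurable_pi_apply 0))
      measurable_const)).2 (hmean.mono fun ω h => ?_)
    change ∫ x, x ∂(ξ ω 0 : Measure ℝ) = 0
    rw [← h, ← (heval (ξ ω) 0).map_eq, integral_map (heval (ξ ω) 0).aemeasurable (by fun_prop)]
  have hpos' : ∀ᵐ e ∂(P.map ξ), 0 < (e 0 : Measure ℝ) (Set.Ioi 0) := by
    refine (ae_map_iff hξ.aemeasurable (measurableSet_lt measurable_const
      (((Measure.measurable_coe measurableSet_Ioi).comp measurable_subtype_coe).comp
        (measurable_pi_apply 0)))).2 (hpos.mono fun ω h => ?_)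
    change 0 < (ξ ω 0 : Measure ℝ) (Set.Ioi 0)
    rw [← (heval (ξ ω) 0).measure_preimage measurableSet_Ioi.nullMeasurableSet]
    exact h
  have hmom' : ∫⁻ e, ∫⁻ x, ‖x‖ₑ ^ (2 + ε) ∂(e 0 : Measure ℝ) ∂(P.map ξ) < ⊤ := by
    have hm : Measurable fun e : RWRE.Env => ∫⁻ x, ‖x‖ₑ ^ (2 + ε) ∂(e 0 : Measure ℝ) :=
      (RWRE.measurable_lintegral_coe (by fun_prop)).comp (measurable_pi_apply 0)
    rw [lintegral_map hm hξ]
    rw [RWRE.annealed, Measure.lintegral_compProd (by fun_prop)] at hmom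
    refine lt_of_eq_of_lt (lintegral_congr fun ω => ?_) hmom
    rw [← (heval (ξ ω) 0).map_eq, lintegral_map (by fun_prop) (by fun_prop)]
    rfl
  -- The parameters solve `(1/2 - 2δ) * p = 1 + γ` with `p = 2 + ε`: the surplus `ε / 2` of `p / 2`
  -- over `1` is shared equally between `γ` and `2δ * p`.
  have hae := RWRE.ae_hasMoment_and_hasGrowth herg.toMeasurePreserving (p := 2 + ε) (by linarith)
    hmean' hmom' hpos' (γ := ε / 4) (δ := ε / (8 * (2 + ε))) (by positivity) (by positivity)
  filter_upwards [ae_of_ae_map hξ.aemeasurable hae] with ω ⟨he, hg⟩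
  refine ⟨he.toIsCentered.integrable_walk, fun y hy => ?_⟩
  refine he.tendsto_Un hg (by linarith) (by positivity) ?_ (by field_simp; ring) hy
  rw [div_le_div_iff₀ (by positivity) (by norm_num)]
  linarith
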